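/- Fix integers $m\ge 1$ and $K\ge 1$, a norm $\|\cdot\|$ on $\mathbb{R}^m$ (for instance the Euclidean one), let $c_m$ be the volume of its unit ball, and let $S=[0,1)^m$ carry the torus metric derived from this norm. Divide $S$ into the $K^m$ equal cubes (regions) $\prod_{i}[j_i/K,(j_i+1)/K)$, $0\le j_i<K$, and give the region $\mathcal R_\ell$ a density $\rho_\ell\ge 0$, where $\sum_\ell \rho_\ell K^{-m}=1$. Let $p\in(0,1)$ and $A_1,A_2>0$ satisfy $pA_1\max_\ell\rho_\ell<1$. The inhomogeneous SPA model generates directed graphs $G_0,G_1,G_2,\dots$ as follows. $G_0$ is empty. At each time $t\ge 1$ a node $v_t\in S$ is added, its position being independent of the past with density $\rho_\ell$ on $\mathcal R_\ell$; then, independently for each node $u$ of $G_{t-1}$ with $v_t\in S(u,t-1)$, a link $(v_t,u)$ is created with probability $p$. Here $\deg^-(u,t)$ is the in-degree of $u$ in $G_t$, and $S(u,t)$ is the ball in the torus centred at $u$ of volume $(A_1\deg^-(u,t)+A_2)/t$ (all of $S$ if this number is at least $1$). Write $\rho(v)$ for the density of the region $\mathcal R(v)$ containing $v$, $\delta(v)$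 for the distance from $v$ to the boundary of the cube $\mathcal R(v)$, and $r(v,t)=\left(\frac{A_1\deg^-(v,t)+A_2}{c_m t}\right)^{1/m}$. **Theorem 1.** Let $\omega=\omega(n)$ be any function tending to infinity with $n$, and let $\varepsilon>0$. Then, for all the parameters above, there is a sequence $\eta(n)\to 0$ such that, with probability $1-o(n^{-1})$ as $n\to\infty$, the following holds. For every node $v\in\{v_1,\dots,v_n\}$ whose in-degree $k=\deg^-(v,n)$ satisfies $k\ge\omega^2\log n$ and for which $$\delta(v)\ \ge\ (1+\varepsilon)\left(\frac{A_1k+A_2}{c_m n}\right)^{1/m}=(1+\varepsilon)\,r(v,n),$$ and for every integer $t$ with $\max\{t_v,T_v\}\le t\le n$, where $$T_v=n\left(\frac{\omega\log n}{k}\right)^{\frac1{p\rho(v)A_1}},\qquad t_v=(1+\varepsilon)\left(\frac{A_1k}{\delta(v)^m\,c_m\,n^{p\rho(v)A_1}}\right)^{\frac1{1-p\rho(v)A_1}},$$ we have $$\left|\deg^-(v,t)-k\left(\frac tn\right)^{p\rho(v)A_1}\right|\ \le\ \eta(n)\,k\left(\frac tn\right)^{p\rho(v)A_1},$$ that is,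 $\deg^-(v,t)=(1+o(1))\,k\,(t/n)^{p\rho(v)A_1}$, uniformly in $v$ and $t$. -/

import Mathlib

open MeasureTheory Filter Topology

noncomputable section

/-- Parameters of the inhomogeneous spatial preferential attachment (SPA) model in dimension `m`:
a norm `N` on `ℝ^m` (the Euclidean one, or any other) inducing the torus metric on `[0,1)^m`,
a subdivision of the unit cube into `K ^ m` equal cubes with densities `ρ j`,
the link probability `p`, and the constants `A₁`, `A₂` of the spheres of influence. -/
structure SPAModel (m : ℕ) where
  m_pos : 0 < m
  /-- the norm on `ℝ^m` -/
  N : Seminorm ℝ (Fin m → ℝ)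
  N_definite : ∀ x, N x = 0 → x = 0
  /-- number of subdivisions of each side of the unit cube -/
  K : ℕ
  K_pos : 0 < K
  /-- density of the region with index `j` -/
  ρ : (Fin m → Fin K) → ℝ
  ρ_nonneg : ∀ j, 0 ≤ ρ j
  /-- the locally constant density integrates to one -/
  ρ_total : ∑ j, ρ j * ((K : ℝ) ^ m)⁻¹ = 1
  p : ℝ
  p_pos : 0 < p
  p_lt_one : p < 1
  A₁ : ℝ
  A₁_pos : 0 < A₁
  A₂ : ℝ
  A₂_pos : 0 < A₂
  subcritical : ∀ j, p * A₁ * ρ j < 1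

namespace SPAModel

variable {m : ℕ} (M : SPAModel m)

/-! ### The space and its regions -/

/-- The space `S = [0,1)^m`. -/
def cube (m : ℕ) : Set (Fin m → ℝ) := Set.univ.pi fun _ => Set.Ico 0 1

/-- The region `∏ i, [j i / K, (j i + 1) / K)`. -/
def region (j : Fin m → Fin M.K) : Set (Fin m → ℝ) :=
  Set.univ.pi fun i => Set.Ico (((j i : ℕ) : ℝ) / M.K) ((((j i : ℕ) : ℝ) + 1) / M.K)

/-- The torus metric derived from the norm `N`. -/
def torusDist (x y : Fin m → ℝ) : ℝ := ⨅ z : Fin m → ℤ, M.N (x - y + fun i => (z i : ℝ))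

/-- The volume `c_m` of the unit ball of the norm `N` in `ℝ^m`. -/
def unitBallVolume : ℝ := volume.real {x : Fin m → ℝ | M.N x ≤ 1}

/-- The distance from `x` to the boundary of the region with index `j` (for a point `x` of the
region, the distance in `ℝ^m` and the distance in the torus agree). -/
def boundaryDist (j : Fin m → Fin M.K) (x : Fin m → ℝ) : ℝ :=
  sInf ((fun y => M.N (x - y)) '' frontier (M.region j))

/-! ### Spheres of influence -/

/-- The ball with centre `x` and radius `r` in the torus. -/
def torusBall (x : Fin m → ℝ) (r : ℝ) : Set (Fin m → ℝ) := {y ∈ cube m | M.torusDist x y ≤ r}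

/-- The radius at which a ball of the torus with centre `x` reaches the volume `V`. -/
def ballRadius (x : Fin m → ℝ) (V : ℝ) : ℝ :=
  sInf {r : ℝ | 0 ≤ r ∧ V ≤ volume.real (M.torusBall x r)}

open Classical in
/-- The ball with centre `x` and volume `V` in the torus; the whole space if `1 ≤ V`. -/
def ballOfVolume (x : Fin m → ℝ) (V : ℝ) : Set (Fin m → ℝ) :=
  if 1 ≤ V then cube m else M.torusBall x (M.ballRadius x V)

/-- The sphere of influence, at time `t`, of a node at `x` with in-degree `d`. -/
def sphere (x : Fin m → ℝ) (d t : ℕ) : Set (Fin m → ℝ) :=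
  M.ballOfVolume x ((M.A₁ * d + M.A₂) / t)

/-- The radius `((A₁ d + A₂) / (c_m t)) ^ (1 / m)` of the sphere of influence at time `t` of a
node with in-degree `d`. -/
def radius (d t : ℕ) : ℝ := ((M.A₁ * d + M.A₂) / (M.unitBallVolume * t)) ^ (1 / (m : ℝ))

/-! ### The probability space -/

/-- The law of the position of a node: density `ρ j` on the region with index `j`. -/
def positionLaw : Measure (Fin m → ℝ) :=
  ∑ j, ENNReal.ofReal (M.ρ j) • volume.restrict (M.region j)

/-- The law of a coin that shows `true` with probability `p`. -/
def coinLaw : Measure Bool :=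
  ProbabilityTheory.bernoulliMeasure true false ⟨M.p, M.p_pos.le, M.p_lt_one.le⟩

/-- An outcome: for every time `t`, the position of the node `v_t` and, for every `s`, the coin
that decides whether `v_t` links to `v_s` if it falls in the sphere of influence of `v_s`
(the entries at time `0` are not used). -/
abbrev Outcome (m : ℕ) : Type := ℕ → (Fin m → ℝ) × (ℕ → Bool)

/-- All positions and all coins are independent. -/
def prob : Measure (Outcome m) :=
  Measure.infinitePi fun _ => M.positionLaw.prod (Measure.infinitePi fun _ => M.coinLaw)

theorem volume_region (j : Fin m → Fin M.K) :
    volume (M.region j) = ENNReal.ofReal (((M.K : ℝ) ^ m)⁻¹) := by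
  have hK : (0 : ℝ) < M.K := by exact_mod_cast M.K_pos
  have h : ∀ i : Fin m, (((j i : ℕ) : ℝ) + 1) / M.K - ((j i : ℕ) : ℝ) / M.K = (M.K : ℝ)⁻¹ := by
    intro i
    field_simp
    ring
  rw [region, Real.volume_pi_Ico]
  simp only [h, Finset.prod_const, Finset.card_univ, Fintype.card_fin]
  rw [← ENNReal.ofReal_pow (by positivity), inv_pow]

instance : IsProbabilityMeasure M.positionLaw := by
  constructor
  have h : ∀ j, ENNReal.ofReal (M.ρ j) * ENNReal.ofReal (((M.K : ℝ) ^ m)⁻¹)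
      = ENNReal.ofReal (M.ρ j * ((M.K : ℝ) ^ m)⁻¹) :=
    fun j => (ENNReal.ofReal_mul (M.ρ_nonneg j)).symm
  simp only [positionLaw, Measure.coe_finsetSum, Finset.sum_apply, Measure.smul_apply,
    Measure.restrict_apply_univ, volume_region, smul_eq_mul, h]
  rw [← ENNReal.ofReal_sum_of_nonneg, M.ρ_total, ENNReal.ofReal_one]
  intro j _
  have := M.ρ_nonneg j
  positivity

instance : IsProbabilityMeasure M.coinLaw := by
  unfold coinLaw
  infer_instance

instance : IsProbabilityMeasure M.prob := by
  unfold prob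
  infer_instance

/-! ### The graph process -/

/-- The position of the node `v_t`. -/
def pos (ξ : Outcome m) (t : ℕ) : Fin m → ℝ := (ξ t).1

/-- The coin for the possible link from `v_t` to `v_s`. -/
def coin (ξ : Outcome m) (t s : ℕ) : Bool := (ξ t).2 s

/-- In-degree of the node `s` in the directed graph with edge set `E`. -/
def inDegree (E : Finset (ℕ × ℕ)) (s : ℕ) : ℕ := (E.filter fun e => e.2 = s).card

open Classical in
/-- The edge set of `G_t`, whose nodes are `v_1, …, v_t`; the pair `(u, s)` is a link from `v_u`
to `v_s`. At time `t + 1` the new node links to each node `v_s` of `G_t` whose sphere of influence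
at time `t` contains it and whose coin shows `true`. -/
def edges (ξ : Outcome m) : ℕ → Finset (ℕ × ℕ)
  | 0 => ∅
  | t + 1 => edges ξ t ∪
      ((Finset.Icc 1 t).filter fun s =>
        pos ξ (t + 1) ∈ M.sphere (pos ξ s) (inDegree (edges ξ t) s) t ∧
          coin ξ (t + 1) s = true).image fun s => (t + 1, s)

/-- The in-degree of the node `v_s` at time `t`. -/
def deg (ξ : Outcome m) (s t : ℕ) : ℕ := inDegree (M.edges ξ t) s

/-! ### The times after which the degree is predictable -/

/-- `T_v = n (ω log n / k) ^ (1 / (p ρ A₁))`, where `w` is the value of `ω` at `n`. -/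
def timeT (j : Fin m → Fin M.K) (w : ℝ) (n k : ℕ) : ℝ :=
  n * (w * Real.log n / k) ^ (1 / (M.p * M.ρ j * M.A₁))

/-- `t_v = (1 + ε) (A₁ k / (δ ^ m c_m n ^ (p ρ A₁))) ^ (1 / (1 - p ρ A₁))`. -/
def timet (j : Fin m → Fin M.K) (ε δ : ℝ) (n k : ℕ) : ℝ :=
  (1 + ε) * (M.A₁ * k / (δ ^ m * M.unitBallVolume * (n : ℝ) ^ (M.p * M.ρ j * M.A₁))) ^
    (1 / (1 - M.p * M.ρ j * M.A₁))

/-- The event that at time `n`, for every node `v = v_s` (lying in the region with index `j`, at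
distance `δ` from its boundary) with final in-degree `k ≥ w ^ 2 log n` and `δ ≥ (1 + ε) r(v, n)`,
and for all times `t` with `max {t_v, T_v} ≤ t ≤ n`, the in-degree of `v` at time `t` is
`k (t / n) ^ (p ρ A₁)` up to a relative error of at most `η`. -/
def DegreesPredicted (ξ : Outcome m) (n : ℕ) (w ε η : ℝ) : Prop :=
  ∀ s : ℕ, 1 ≤ s → s ≤ n → ∀ j : Fin m → Fin M.K, pos ξ s ∈ M.region j →
    ∀ k : ℕ, k = M.deg ξ s n → ∀ δ : ℝ, δ = M.boundaryDist j (pos ξ s) →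
    w ^ 2 * Real.log n ≤ k → (1 + ε) * M.radius k n ≤ δ →
    ∀ t : ℕ, max (M.timet j ε δ n k) (M.timeT j w n k) ≤ t → t ≤ n →
      |(M.deg ξ s t : ℝ) - k * ((t : ℝ) / n) ^ (M.p * M.ρ j * M.A₁)| ≤
        η * (k * ((t : ℝ) / n) ^ (M.p * M.ρ j * M.A₁))

end SPAModel

end

/-!
Put `α = p ρ(v) A₁`. As long as the sphere of influence of `v` lies inside the region of `v`, the
quantity `Y = deg⁻(v) + A₂ / A₁` grows at the step from time `u` to `u + 1` by `α Y / u` in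
expectation, so dividing `Y` by the product of the factors `1 + α / u` gives a martingale.
Exponential supermartingales and a union bound over the nodes, the starting times, the regions and
the two signs show that, outside an event of probability `O(n⁻²)`, the logarithms of all these
supermartingales stay below `4 log n` up to time `n`.

Now extrapolate back from time `n`. If `Y` is close to its prediction at all times after `t`, then,
since in-degrees do not decrease and `t ≥ t_v`, the sphere of influence at time `t` is too small to
leave the region, and the bound on the supermartingale gives the estimate at time `t` as well. This
continues as long as the prediction `k (t / n) ^ α` dominates `log n`, that is, for `t ≥ T_v`, where
it is at least `ω log n`; the relative error is of order `ω ^ (-1 / 2)`.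
-/

noncomputable section

/-! ### An exponential inequality for predictable events -/

section InfinitePi

theorem update_preimage_pi {ι : Type*} [DecidableEq ι] {X : ι → Type*} (i : ι) (s : Finset ι)
    (t : ∀ i, Set (X i)) :
    (fun q : (∀ i, X i) × X i => Function.update q.1 i q.2) ⁻¹' (s : Set ι).pi t =
      (↑(s.erase i) : Set ι).pi t ×ˢ {y | i ∈ s → y ∈ t i} := by
  ext q
  simp only [Set.mem_preimage, Set.mem_pi, Finset.mem_coe, Set.mem_prod, Finset.mem_erase,
    Set.mem_ofPred_eq]
  constructor
  · refine fun h => ⟨fun l hl => ?_, fun hi => ?_⟩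
    · simpa only [Function.update_of_ne hl.1] using h l hl.2
    · simpa only [Function.update_self] using h i hi
  · rintro ⟨h, hi⟩ l hl
    rcases eq_or_ne l i with rfl | hli
    · simpa only [Function.update_self] using hi hl
    · simpa only [Function.update_of_ne hli] using h l ⟨hli, hl⟩

theorem map_update_infinitePi_prod {ι : Type*} [DecidableEq ι] {X : ι → Type*}
    [∀ i, MeasurableSpace (X i)] (μ : ∀ i, Measure (X i)) [∀ i, IsProbabilityMeasure (μ i)]
    (i : ι) :
    ((Measure.infinitePi μ).prod (μ i)).map (fun q => Function.update q.1 i q.2) =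
      Measure.infinitePi μ := by
  refine Measure.eq_infinitePi _ fun s t ht => ?_
  rw [Measure.map_apply measurable_update' (.pi s.countable_toSet fun i _ => ht i),
    update_preimage_pi, Measure.prod_prod, Measure.infinitePi_pi μ fun i _ => ht i]
  by_cases hi : i ∈ s
  · simp only [hi, true_imp_iff, Set.ofPred_mem_eq, Finset.prod_erase_mul]
  · simp only [hi, false_imp_iff, Set.ofPred_true, measure_univ, mul_one, Finset.erase_eq_of_notMem,
      not_false_eq_true]

theorem lintegral_infinitePi_update {ι : Type*} [DecidableEq ι] {X : ι → Type*}
    [∀ i, MeasurableSpace (X i)] (μ : ∀ i, Measure (X i)) [∀ i, IsProbabilityMeasure (μ i)]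
    (i : ι) {f : (∀ i, X i) → ENNReal} (hf : Measurable f) :
    ∫⁻ ξ, f ξ ∂Measure.infinitePi μ =
      ∫⁻ ξ, ∫⁻ y, f (Function.update ξ i y) ∂μ i ∂Measure.infinitePi μ := by
  conv_lhs => rw [← map_update_infinitePi_prod μ i]
  rw [lintegral_map hf measurable_update']
  exact lintegral_prod _ (hf.comp measurable_update').aemeasurable

end InfinitePi

theorem exp_compensated_bernoulli_le_one {w q : ℝ} (hw : |w| ≤ 1) (hq : 0 ≤ q) :
    Real.exp (w * (1 - q) - w ^ 2 * q) * q + Real.exp (w * (0 - q) - w ^ 2 * q) * (1 - q) ≤ 1 := by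
  have hsplit : Real.exp (w * (1 - q) - w ^ 2 * q) =
      Real.exp w * Real.exp (w * (0 - q) - w ^ 2 * q) := by
    rw [← Real.exp_add]
    ring_nf
  have hexp : Real.exp w ≤ 1 + w + w ^ 2 := by
    linarith [(abs_le.1 (Real.abs_exp_sub_one_sub_id_le hw)).2]
  calc Real.exp (w * (1 - q) - w ^ 2 * q) * q + Real.exp (w * (0 - q) - w ^ 2 * q) * (1 - q)
      = Real.exp (w * (0 - q) - w ^ 2 * q) * (q * (Real.exp w - 1) + 1) := by
        rw [hsplit]
        ring
    _ ≤ Real.exp (w * (0 - q) - w ^ 2 * q) * (q * (w + w ^ 2) + 1) := by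
        gcongr
        linarith
    _ ≤ Real.exp (w * (0 - q) - w ^ 2 * q) * Real.exp (q * (w + w ^ 2)) := by
        gcongr
        exact Real.add_one_le_exp _
    _ = 1 := by
        rw [← Real.exp_add, ← Real.exp_zero]
        ring_nf

theorem lintegral_exp_compensated_indicator_le_one {Ω : Type*} [MeasurableSpace Ω]
    (ν : Measure Ω) [IsProbabilityMeasure ν] {A : Set Ω} (hA : MeasurableSet A) {w : ℝ}
    (hw : |w| ≤ 1) :
    ∫⁻ y, ENNReal.ofReal (Real.exp (w * (A.indicator 1 y - ν.real A) - w ^ 2 * ν.real A)) ∂ν ≤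
      1 := by
  set f : ℝ → ENNReal := fun x => ENNReal.ofReal (Real.exp (w * (x - ν.real A) - w ^ 2 * ν.real A))
  calc ∫⁻ y, f (A.indicator 1 y) ∂ν
      = ∫⁻ y in A, f (A.indicator 1 y) ∂ν + ∫⁻ y in Aᶜ, f (A.indicator 1 y) ∂ν :=
        (lintegral_add_compl _ hA).symm
    _ = ∫⁻ _ in A, f 1 ∂ν + ∫⁻ _ in Aᶜ, f 0 ∂ν := by
        congr 1
        · exact setLIntegral_congr_fun hA fun y hy => by simp [hy]
        · exact setLIntegral_congr_fun hA.compl fun y hy => by simp [Set.notMem_of_mem_compl hy]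
    _ = ENNReal.ofReal (Real.exp (w * (1 - ν.real A) - w ^ 2 * ν.real A) * ν.real A +
          Real.exp (w * (0 - ν.real A) - w ^ 2 * ν.real A) * ν.real Aᶜ) := by
        rw [setLIntegral_const, setLIntegral_const, ENNReal.ofReal_add (by positivity)
          (by positivity), ENNReal.ofReal_mul (Real.exp_nonneg _),
          ENNReal.ofReal_mul (Real.exp_nonneg _), ofReal_measureReal, ofReal_measureReal]
    _ ≤ 1 := by
        rw [probReal_compl_eq_one_sub hA]
        exact ENNReal.ofReal_le_one.2 (exp_compensated_bernoulli_le_one hw measureReal_nonneg)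

section CompensatedSum

variable {X : ℕ → Type*} [∀ i, MeasurableSpace (X i)] (μ : ∀ i, Measure (X i))
  (E : ∀ u, (∀ i, X i) → Set (X (u + 1))) (w : ℕ → ℝ)

/-- The logarithm of the exponential supermartingale of a sequence of events: at time `u + 1` the
coordinate `ξ (u + 1)` is tested against the set `E u ξ`, which is meant to depend on
`ξ 0, …, ξ u` only; the outcome is centred, multiplied by `w u`, and the sum over `u ∈ [a, b)` is
compensated by the bound `w u ^ 2 * μ (E u ξ)` for its conditional exponential moments. -/
def compensatedSum (a b : ℕ) (ξ : ∀ i, X i) : ℝ :=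
  ∑ u ∈ Finset.Ico a b, (w u * ((E u ξ).indicator 1 (ξ (u + 1)) - (μ (u + 1)).real (E u ξ)) -
    w u ^ 2 * (μ (u + 1)).real (E u ξ))

variable {E} in
theorem measurable_compensatedSum [∀ i, SFinite (μ i)]
    (hE : ∀ u, MeasurableSet {q : (∀ i, X i) × X (u + 1) | q.2 ∈ E u q.1}) (a b : ℕ) :
    Measurable (compensatedSum μ E w a b) := by
  refine Finset.measurable_sum _ fun u _ => ?_
  have hprob : Measurable fun ξ => (μ (u + 1)).real (E u ξ) :=
    (measurable_measure_prodMk_left (hE u)).ennreal_toReal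
  have hind : Measurable fun ξ : ∀ i, X i => (E u ξ).indicator (1 : X (u + 1) → ℝ) (ξ (u + 1)) :=
    (measurable_one.indicator (hE u)).comp (measurable_id.prodMk (measurable_pi_apply (u + 1)))
  exact ((hind.sub hprob).const_mul _).sub (hprob.const_mul _)

variable {E}

theorem compensatedSum_update_succ {a b : ℕ} (hab : a ≤ b)
    (hpred : ∀ u, a ≤ u → DependsOn (E u) (Set.Iic u)) (ξ : ∀ i, X i) (y : X (b + 1)) :
    compensatedSum μ E w a (b + 1) (Function.update ξ (b + 1) y) =
      compensatedSum μ E w a b ξ + (w b * ((E b ξ).indicator 1 y - (μ (b + 1)).real (E b ξ)) -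
        w b ^ 2 * (μ (b + 1)).real (E b ξ)) := by
  have hset : ∀ u ∈ Finset.Icc a b, E u (Function.update ξ (b + 1) y) = E u ξ := by
    intro u hu
    rw [Finset.mem_Icc] at hu
    refine hpred u hu.1 fun i hi => Function.update_of_ne ?_ _ _
    rw [Set.mem_Iic] at hi
    lia
  rw [compensatedSum, Finset.sum_Ico_succ_top hab, hset b (Finset.right_mem_Icc.2 hab),
    Function.update_self, compensatedSum]
  congr 1
  refine Finset.sum_congr rfl fun u hu => ?_
  rw [Finset.mem_Ico] at hu
  rw [hset u (Finset.mem_Icc.2 ⟨hu.1, hu.2.le⟩), Function.update_of_ne (by lia)]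

variable [∀ i, IsProbabilityMeasure (μ i)]
  (hE : ∀ u, MeasurableSet {q : (∀ i, X i) × X (u + 1) | q.2 ∈ E u q.1}) {w}
  (hw : ∀ u, |w u| ≤ 1) {a : ℕ} (hpred : ∀ u, a ≤ u → DependsOn (E u) (Set.Iic u))
include hE hw hpred

theorem lintegral_exp_compensatedSum_le_one (b : ℕ) :
    ∫⁻ ξ, ENNReal.ofReal (Real.exp (compensatedSum μ E w a b ξ)) ∂Measure.infinitePi μ ≤ 1 := by
  induction b with
  | zero => simp [compensatedSum]
  | succ b ih =>
    rcases lt_or_ge b a with hb | hb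
    · simp [compensatedSum, Finset.Ico_eq_empty_of_le (Nat.succ_le_of_lt hb)]
    -- Integrating out the coordinate `b + 1` first removes the last term of the sum.
    rw [lintegral_infinitePi_update μ (b + 1)
      (measurable_compensatedSum μ w hE a (b + 1)).exp.ennreal_ofReal]
    refine (lintegral_mono fun ξ => ?_).trans ih
    simp only [compensatedSum_update_succ μ w hb hpred, Real.exp_add,
      ENNReal.ofReal_mul (Real.exp_nonneg _)]
    rw [lintegral_const_mul' _ _ ENNReal.ofReal_ne_top]
    exact mul_le_of_le_one_right zero_le (lintegral_exp_compensated_indicator_le_one _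
      (measurable_prodMk_left (hE b)) (hw b))

theorem measureReal_le_compensatedSum_le (b : ℕ) (L : ℝ) :
    (Measure.infinitePi μ).real {ξ | L ≤ compensatedSum μ E w a b ξ} ≤ Real.exp (-L) := by
  have hmarkov := (mul_meas_ge_le_lintegral (μ := Measure.infinitePi μ)
    (measurable_compensatedSum μ w hE a b).exp.ennreal_ofReal (ENNReal.ofReal (Real.exp L))).trans
    (lintegral_exp_compensatedSum_le_one μ hE hw hpred b)
  simp only [ENNReal.ofReal_le_ofReal_iff (Real.exp_nonneg _), Real.exp_le_exp] at hmarkov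
  have hreal := ENNReal.toReal_mono ENNReal.one_ne_top hmarkov
  rw [ENNReal.toReal_mul, ENNReal.toReal_ofReal (Real.exp_nonneg _), ENNReal.toReal_one] at hreal
  rwa [Real.exp_neg, ← one_div, le_div_iff₀' (Real.exp_pos _)]

end CompensatedSum


/-! ### Growth of solutions of `y (u + 1) - y u = α * y u / u` -/

section Growth

/-- The factor by which a solution of `y (u + 1) - y u = α * y u / u` grows from time `a` to
time `b`; it is asymptotic to `(b / a) ^ α`. -/
def growth (α : ℝ) (a b : ℕ) : ℝ := ∏ i ∈ Finset.Ico a b, (1 + α / i)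

theorem growth_self (α : ℝ) (a : ℕ) : growth α a a = 1 := by simp [growth]

theorem growth_succ (α : ℝ) {a b : ℕ} (hab : a ≤ b) :
    growth α a (b + 1) = growth α a b * (1 + α / b) :=
  Finset.prod_Ico_succ_top hab _

theorem growth_mul_growth (α : ℝ) {a b c : ℕ} (hab : a ≤ b) (hbc : b ≤ c) :
    growth α a b * growth α b c = growth α a c :=
  Finset.prod_Ico_consecutive _ hab hbc

variable {α : ℝ} (h0 : 0 ≤ α)
include h0

theorem one_le_growth (a b : ℕ) : 1 ≤ growth α a b :=
  Finset.prod_induction _ (fun x => 1 ≤ x) (fun _ _ => one_le_mul_of_one_le_of_one_le) le_rfl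
    fun _ _ => le_add_of_nonneg_right (by positivity)

theorem growth_pos (a b : ℕ) : 0 < growth α a b :=
  one_pos.trans_le (one_le_growth h0 a b)

variable (h1 : α ≤ 1) {t n : ℕ} (htn : t ≤ n)
include h1 htn

theorem rpow_div_le_growth (ht : 0 < t) : ((n : ℝ) / t) ^ α ≤ growth α t n := by
  have ht' : (0 : ℝ) < t := by exact_mod_cast ht
  induction n, htn using Nat.le_induction with
  | base => rw [growth_self, div_self ht'.ne', Real.one_rpow]
  | succ n hn ih =>
    have hn' : (0 : ℝ) < n := by exact_mod_cast ht.trans_le hn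
    have hbernoulli : (1 + 1 / n : ℝ) ^ α ≤ 1 + α / n := by
      have := rpow_one_add_le_one_add_mul_self (s := 1 / (n : ℝ))
        (neg_one_lt_zero.le.trans (by positivity)) h0 h1
      rwa [mul_one_div] at this
    calc (((n + 1 : ℕ) : ℝ) / t) ^ α = (n / t) ^ α * (1 + 1 / n) ^ α := by
          rw [← Real.mul_rpow (by positivity) (by positivity)]
          congr 1
          push_cast
          field_simp
      _ ≤ growth α t n * (1 + α / n) := by
          have := growth_pos h0 t n
          gcongr
      _ = growth α t (n + 1) := (growth_succ α hn).symm

theorem growth_le_rpow_div (ht : 2 ≤ t) : growth α t n ≤ (((n : ℝ) - 1) / (t - 1)) ^ α := by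
  have ht1 : (0 : ℝ) < t - 1 := sub_pos.2 (by exact_mod_cast ht)
  induction n, htn using Nat.le_induction with
  | base => rw [growth_self, div_self ht1.ne', Real.one_rpow]
  | succ n hn ih =>
    have hn1 : (0 : ℝ) < n - 1 := sub_pos.2 (by exact_mod_cast ht.trans hn)
    have hn' : (0 : ℝ) < n := by linarith
    -- Bernoulli gives `((n - 1) / n) ^ α ≤ 1 - α / n`, and `(1 + α / n) * (1 - α / n) ≤ 1`.
    have hbernoulli : (1 + α / n) * ((n - 1) / n : ℝ) ^ α ≤ 1 := by
      have h := rpow_one_add_le_one_add_mul_self (s := -1 / (n : ℝ)) (by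
        rw [neg_div, neg_le_neg_iff, div_le_one hn']
        linarith) h0 h1
      rw [show 1 + -1 / (n : ℝ) = (n - 1) / n by field_simp; ring] at h
      calc (1 + α / n) * ((n - 1) / n : ℝ) ^ α ≤ (1 + α / n) * (1 + α * (-1 / n)) := by gcongr
        _ = 1 - (α / n) ^ 2 := by ring
        _ ≤ 1 := sub_le_self _ (sq_nonneg _)
    calc growth α t (n + 1) = growth α t n * (1 + α / n) := growth_succ α hn
      _ ≤ ((n - 1) / (t - 1)) ^ α * (n / (n - 1)) ^ α := by
          gcongr
          rw [← inv_div ((n : ℝ) - 1), Real.inv_rpow (by positivity), ← one_div,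
            le_div_iff₀ (by positivity)]
          exact hbernoulli
      _ = (((n + 1 : ℕ) - 1) / (t - 1)) ^ α := by
          rw [← Real.mul_rpow (by positivity) (by positivity)]
          congr 1
          push_cast
          field_simp
          ring

theorem inv_growth_le_rpow (ht : 0 < t) : (growth α t n)⁻¹ ≤ ((t : ℝ) / n) ^ α := by
  have : (0 : ℝ) < t := by exact_mod_cast ht
  have hn' : (0 : ℝ) < n := by exact_mod_cast ht.trans_le htn
  rw [← inv_div (n : ℝ), Real.inv_rpow (by positivity)]
  exact inv_anti₀ (by positivity) (rpow_div_le_growth h0 h1 htn ht)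

theorem rpow_mul_one_sub_le_inv_growth (ht : 2 ≤ t) :
    ((t : ℝ) / n) ^ α * (1 - 1 / t) ≤ (growth α t n)⁻¹ := by
  have ht1 : (0 : ℝ) < t - 1 := sub_pos.2 (by exact_mod_cast ht)
  have ht' : (0 : ℝ) < t := by linarith
  have htn' : (t : ℝ) ≤ n := by exact_mod_cast htn
  have hsub : 0 ≤ 1 - 1 / (t : ℝ) := by
    rw [sub_nonneg, div_le_one ht']
    linarith
  rw [← one_div, le_div_iff₀ (growth_pos h0 t n)]
  calc ((t : ℝ) / n) ^ α * (1 - 1 / t) * growth α t n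
      ≤ (t / n) ^ α * (1 - 1 / t) * ((n - 1) / (t - 1)) ^ α := by
        gcongr
        exact growth_le_rpow_div h0 h1 htn ht
    _ = (t / n * ((n - 1) / (t - 1))) ^ α * (1 - 1 / t) := by
        rw [Real.mul_rpow (by positivity) (div_nonneg (by linarith) ht1.le)]
        ring
    _ ≤ (t / (t - 1)) ^ α * (1 - 1 / t) := by
        gcongr
        · exact mul_nonneg (by positivity) (div_nonneg (by linarith) ht1.le)
        · rw [div_mul_div_comm, div_le_div_iff₀ (mul_pos (by linarith) ht1) ht1]
          nlinarith
    _ ≤ (t / (t - 1)) * (1 - 1 / t) := by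
        gcongr
        exact Real.rpow_le_self_of_one_le ((one_le_div ht1).2 (by linarith)) h1
    _ = 1 := by field_simp

theorem add_div_growth_le (ht : 0 < t) {x y : ℝ} (hx : 0 ≤ x) (hy : 0 ≤ y) :
    (x + y) / growth α t n ≤ x * ((t : ℝ) / n) ^ α + y := by
  rw [add_div, div_eq_mul_inv x]
  exact add_le_add (mul_le_mul_of_nonneg_left (inv_growth_le_rpow h0 h1 htn ht) hx)
    (div_le_self hy (one_le_growth h0 t n))

theorem le_add_div_growth (ht : 2 ≤ t) {x y : ℝ} (hx : 0 ≤ x) (hy : 0 ≤ y) :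
    x * ((t : ℝ) / n) ^ α * (1 - 1 / t) ≤ (x + y) / growth α t n := by
  rw [add_div, div_eq_mul_inv x, mul_assoc]
  exact le_add_of_le_of_nonneg
    (mul_le_mul_of_nonneg_left (rpow_mul_one_sub_le_inv_growth h0 h1 htn ht) hx)
    (div_nonneg hy (growth_pos h0 t n).le)

end Growth

section Extrapolation

variable {α : ℝ} (h0 : 0 ≤ α) {t n : ℕ} (htn : t ≤ n) {Y I q : ℕ → ℝ}
include h0 htn

theorem sum_compensated_div_growth
    (hstep : ∀ u ∈ Finset.Ico t n, Y (u + 1) = Y u + I u)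
    (hq : ∀ u ∈ Finset.Ico t n, q u = α / u * Y u) :
    ∑ u ∈ Finset.Ico t n, (I u - q u) / growth α t (u + 1) = Y n / growth α t n - Y t := by
  rw [← div_one (Y t), ← growth_self α t,
    ← Finset.sum_Ico_sub (fun u => Y u / growth α t u) htn]
  refine Finset.sum_congr rfl fun u hu => ?_
  have hpos := growth_pos h0 t u
  have hfac : 0 < 1 + α / u := by positivity
  rw [hstep u hu, hq u hu, growth_succ α (Finset.mem_Ico.1 hu).1]
  generalize α / (u : ℝ) = x at *
  field_simp
  ring

theorem sum_div_growth :
    ∑ u ∈ Finset.Ico t n, α / u / growth α t (u + 1) = 1 - (growth α t n)⁻¹ := by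
  have h := sum_compensated_div_growth h0 htn (Y := 1) (I := 0) (q := fun u => α / u)
    (fun _ _ => by simp) (fun _ _ => by simp)
  simp only [Pi.zero_apply, Pi.one_apply, zero_sub, neg_div, Finset.sum_neg_distrib, one_div] at h
  linarith

theorem sum_div_growth_sq_le {D : ℝ} (hD : 0 ≤ D)
    (hq : ∀ u ∈ Finset.Ico t n, q u = α / u * Y u)
    (hY : ∀ u ∈ Finset.Ico t n, Y u / growth α t (u + 1) ≤ D) :
    ∑ u ∈ Finset.Ico t n, q u / growth α t (u + 1) ^ 2 ≤ D := by
  calc ∑ u ∈ Finset.Ico t n, q u / growth α t (u + 1) ^ 2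
      = ∑ u ∈ Finset.Ico t n, Y u / growth α t (u + 1) * (α / u / growth α t (u + 1)) :=
        Finset.sum_congr rfl fun u hu => by rw [hq u hu]; ring
    _ ≤ ∑ u ∈ Finset.Ico t n, D * (α / u / growth α t (u + 1)) := by
        refine Finset.sum_le_sum fun u hu => mul_le_mul_of_nonneg_right (hY u hu) ?_
        have := growth_pos h0 t (u + 1)
        positivity
    _ = D * (1 - (growth α t n)⁻¹) := by rw [← Finset.mul_sum, sum_div_growth h0 htn]
    _ ≤ D := mul_le_of_le_one_right hD
        (sub_le_self _ (inv_nonneg.2 (growth_pos h0 t n).le))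

theorem abs_sub_div_growth_le {D L θ : ℝ} (hD : 0 ≤ D) (hθ : 0 < θ)
    (hstep : ∀ u ∈ Finset.Ico t n, Y (u + 1) = Y u + I u)
    (hq : ∀ u ∈ Finset.Ico t n, q u = α / u * Y u)
    (hY : ∀ u ∈ Finset.Ico t n, Y u / growth α t (u + 1) ≤ D)
    (hexp : ∀ τ ∈ ({θ, -θ} : Finset ℝ), ∑ u ∈ Finset.Ico t n,
      (τ / growth α t (u + 1) * (I u - q u) - (τ / growth α t (u + 1)) ^ 2 * q u) ≤ L) :
    |Y t - Y n / growth α t n| ≤ θ * D + L / θ := by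
  have hsum : ∀ τ ∈ ({θ, -θ} : Finset ℝ), τ * (Y n / growth α t n - Y t) ≤ θ ^ 2 * D + L := by
    intro τ hτ
    have hτ2 : τ ^ 2 = θ ^ 2 := sq_eq_sq_iff_eq_or_eq_neg.2 (by simpa using hτ)
    have hsplit : ∑ u ∈ Finset.Ico t n,
        (τ / growth α t (u + 1) * (I u - q u) - (τ / growth α t (u + 1)) ^ 2 * q u) =
        τ * (Y n / growth α t n - Y t) -
          θ ^ 2 * ∑ u ∈ Finset.Ico t n, q u / growth α t (u + 1) ^ 2 := by
      rw [← sum_compensated_div_growth h0 htn hstep hq, Finset.mul_sum, Finset.mul_sum,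
        ← Finset.sum_sub_distrib]
      refine Finset.sum_congr rfl fun u _ => ?_
      rw [div_pow, hτ2]
      ring
    have hvar := mul_le_mul_of_nonneg_left (sum_div_growth_sq_le h0 htn hD hq hY) (sq_nonneg θ)
    linarith [hexp τ hτ]
  have hscale : θ * D + L / θ = (θ ^ 2 * D + L) / θ := by field_simp
  rw [abs_sub_comm, abs_le', hscale, le_div_iff₀' hθ, le_div_iff₀' hθ]
  refine ⟨hsum θ (by simp), ?_⟩
  rw [mul_neg, ← neg_mul]
  exact hsum (-θ) (by simp)

omit htn in
/-- Going back in time from `n`, the conclusion at later times bounds `Y` at the earlier ones, where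
the drift `hq` then applies. -/
theorem abs_sub_div_growth_le_of_drift {a : ℕ} {L θ : ℝ} (hθ : 0 < θ) (hθ' : 10 * θ ≤ 1)
    (hYn : 0 ≤ Y n)
    (hstep : ∀ u ∈ Finset.Ico a n, Y (u + 1) = Y u + I u)
    (hI : ∀ u ∈ Finset.Ico a n, 0 ≤ I u)
    (hq : ∀ u ∈ Finset.Ico a n, Y u ≤ (1 + 10 * θ) * (Y n / growth α (u + 1) n) →
      q u = α / u * Y u)
    (hL : ∀ t ∈ Finset.Icc a n, L ≤ 8 * θ ^ 2 * (Y n / growth α t n))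
    (hexp : ∀ t ∈ Finset.Icc a n, ∀ τ ∈ ({θ, -θ} : Finset ℝ), ∑ u ∈ Finset.Ico t n,
      (τ / growth α t (u + 1) * (I u - q u) - (τ / growth α t (u + 1)) ^ 2 * q u) ≤ L)
    {t : ℕ} (hat : a ≤ t) (htn : t ≤ n) :
    |Y t - Y n / growth α t n| ≤ 10 * θ * (Y n / growth α t n) := by
  have hD : ∀ u, 0 ≤ Y n / growth α u n := fun u => div_nonneg hYn (growth_pos h0 u n).le
  induction hd : n - t using Nat.strong_induction_on generalizing t with
  | _ d ih =>
    have hlater : ∀ u ∈ Finset.Ico t n, Y u ≤ (1 + 10 * θ) * (Y n / growth α (u + 1) n) := by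
      intro u hu
      have hu' := Finset.mem_Ico.1 hu
      have hau : u ∈ Finset.Ico a n := Finset.Ico_subset_Ico_left hat hu
      calc Y u ≤ Y (u + 1) := by linarith [hstep u hau, hI u hau]
        _ ≤ _ := by
          linarith [(abs_le.1 (ih (n - (u + 1)) (by lia) (t := u + 1) (by lia) hu'.2 rfl)).2]
    have hsub := Finset.Ico_subset_Ico_left (b := n) hat
    have hY : ∀ u ∈ Finset.Ico t n, Y u / growth α t (u + 1) ≤ 2 * (Y n / growth α t n) := by
      intro u hu
      have hu' := Finset.mem_Ico.1 hu
      rw [div_le_iff₀ (growth_pos h0 t _),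
        ← growth_mul_growth α (Nat.le_succ_of_le hu'.1) (Nat.succ_le_of_lt hu'.2)]
      calc Y u ≤ 2 * (Y n / growth α (u + 1) n) :=
            (hlater u hu).trans (mul_le_mul_of_nonneg_right (by linarith) (hD _))
        _ = _ := by
            have := growth_pos h0 t (u + 1)
            field_simp
    have htmem : t ∈ Finset.Icc a n := Finset.mem_Icc.2 ⟨hat, htn⟩
    calc |Y t - Y n / growth α t n| ≤ θ * (2 * (Y n / growth α t n)) + L / θ :=
          abs_sub_div_growth_le h0 htn (mul_nonneg zero_le_two (hD t)) hθ
            (fun u hu => hstep u (hsub hu)) (fun u hu => hq u (hsub hu) (hlater u hu)) hY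
            (hexp t htmem)
      _ ≤ θ * (2 * (Y n / growth α t n)) + 8 * θ * (Y n / growth α t n) := by
          gcongr
          rw [div_le_iff₀ hθ]
          linarith [hL t htmem]
      _ = 10 * θ * (Y n / growth α t n) := by ring

end Extrapolation

/-! ### Balls of the norm and of the torus -/

section Seminorm

variable {E : Type*} [NormedAddCommGroup E] [NormedSpace ℝ E] [FiniteDimensional ℝ E]
  [MeasurableSpace E] [BorelSpace E] (μ : Measure E) [μ.IsAddHaarMeasure] (N : Seminorm ℝ E)

open scoped Pointwise in
theorem measureReal_seminorm_closedBall (x : E) {r : ℝ} (hr : 0 < r) :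
    μ.real (N.closedBall x r) = r ^ Module.finrank ℝ E * μ.real (N.closedBall 0 1) := by
  have hball : N.closedBall x r = x +ᵥ r • N.closedBall 0 1 := by
    rw [Seminorm.smul_closedBall_zero (norm_pos_iff.2 hr.ne'), Seminorm.vadd_closedBall,
      Real.norm_of_nonneg hr.le, mul_one, vadd_eq_add, add_zero]
  rw [hball, measureReal_def, measure_vadd, Measure.addHaar_smul, abs_of_pos (pow_pos hr _),
    ENNReal.toReal_mul, ENNReal.toReal_ofReal (pow_pos hr _).le, measureReal_def]

variable {N}

theorem measure_seminorm_unitBall_lt_top [Nontrivial E] (hN : ∀ x, N x = 0 → x = 0) :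
    μ (N.closedBall 0 1) < ⊤ := by
  have hsmul : ∀ (r : ℝ) (x : E), N (r • x) ≤ |r| * N x := fun r x => (map_smul_eq_mul N r x).le
  rw [Seminorm.closedBall_zero_eq, measure_le_eq_lt μ (map_zero N) (map_neg_eq_map N)
    (map_add_le_add N) (hN _) hsmul, measure_lt_one_eq_integral_div_gamma μ (map_zero N)
    (map_neg_eq_map N) (map_add_le_add N) (hN _) hsmul one_pos]
  exact ENNReal.ofReal_lt_top

theorem measureReal_seminorm_unitBall_pos [Nontrivial E] (hN : ∀ x, N x = 0 → x = 0) :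
    0 < μ.real (N.closedBall 0 1) := by
  refine ENNReal.toReal_pos (ne_of_gt ?_) (measure_seminorm_unitBall_lt_top μ hN).ne
  have hopen : IsOpen {x | N x < 1} :=
    isOpen_lt N.convexOn.locallyLipschitz.continuous continuous_const
  refine (hopen.measure_pos μ ⟨0, by simp⟩).trans_le (measure_mono fun x hx => ?_)
  rw [Seminorm.mem_closedBall_zero]
  exact le_of_lt hx

end Seminorm

theorem subset_of_isPreconnected_of_disjoint_frontier {X : Type*} [TopologicalSpace X]
    {s t : Set X} (hs : IsPreconnected s) (hst : Disjoint s (frontier t))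
    (hne : (s ∩ t).Nonempty) : s ⊆ t := by
  have hcover : s ⊆ interior t ∪ interior tᶜ := by
    rw [← compl_frontier_eq_union_interior]
    exact hst.subset_compl_right
  obtain ⟨x, hxs, hxt⟩ := hne
  refine (hs.subset_left_of_subset_union isOpen_interior isOpen_interior
    (disjoint_compl_right.mono interior_subset interior_subset) hcover
    ⟨x, hxs, (hcover hxs).resolve_right fun h => interior_subset h hxt⟩).trans interior_subset

namespace SPAModel

variable {m : ℕ} (M : SPAModel m)

theorem continuous_N : Continuous M.N :=
  M.N.convexOn.locallyLipschitz.continuous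

include M in
theorem nontrivial_space : Nontrivial (Fin m → ℝ) := by
  have : Nonempty (Fin m) := ⟨⟨0, M.m_pos⟩⟩
  infer_instance

theorem unitBallVolume_eq : M.unitBallVolume = volume.real (M.N.closedBall 0 1) := by
  rw [unitBallVolume, Seminorm.closedBall_zero_eq]

theorem unitBallVolume_pos : 0 < M.unitBallVolume := by
  have := M.nontrivial_space
  rw [unitBallVolume_eq]
  exact measureReal_seminorm_unitBall_pos volume M.N_definite

theorem volume_closedBall (x : Fin m → ℝ) {r : ℝ} (hr : 0 ≤ r) :
    volume.real (M.N.closedBall x r) = M.unitBallVolume * r ^ m := by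
  rcases hr.eq_or_lt with rfl | hr
  · have := M.nontrivial_space
    have hsub : M.N.closedBall x 0 ⊆ {x} := fun y hy =>
      sub_eq_zero.1 (M.N_definite _ (le_antisymm hy (apply_nonneg _ _)))
    rw [zero_pow M.m_pos.ne', mul_zero, measureReal_def, measure_mono_null hsub
      (measure_singleton x), ENNReal.toReal_zero]
  · rw [measureReal_seminorm_closedBall volume M.N x hr, Module.finrank_fin_fun,
      unitBallVolume_eq, mul_comm]

theorem measurableSet_region (j : Fin m → Fin M.K) : MeasurableSet (M.region j) :=
  MeasurableSet.univ_pi fun _ => measurableSet_Ico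

theorem measurableSet_cube : MeasurableSet (cube m) :=
  MeasurableSet.univ_pi fun _ => measurableSet_Ico

theorem volume_cube : volume (cube m) = 1 := by
  simp [cube, Real.volume_pi_Ico]

theorem measureReal_le_one_of_subset_cube {B : Set (Fin m → ℝ)} (hB : B ⊆ cube m) :
    volume.real B ≤ 1 :=
  ENNReal.toReal_le_of_le_ofReal zero_le_one
    ((measure_mono hB).trans (by rw [volume_cube, ENNReal.ofReal_one]))

theorem region_subset_cube (j : Fin m → Fin M.K) : M.region j ⊆ cube m := by
  have hK : (0 : ℝ) < M.K := by exact_mod_cast M.K_pos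
  refine Set.pi_mono fun i _ => Set.Ico_subset_Ico (by positivity) ?_
  rw [div_le_one hK]
  exact_mod_cast (j i).2

theorem eq_of_mem_region {i j : Fin m → Fin M.K} {y : Fin m → ℝ} (hi : y ∈ M.region i)
    (hj : y ∈ M.region j) : i = j := by
  have hK : (0 : ℝ) < M.K := by exact_mod_cast M.K_pos
  have hle : ∀ {i j : Fin m → Fin M.K}, y ∈ M.region i → y ∈ M.region j → i ≤ j := by
    intro i j hi hj l
    have h := (hi l trivial).1.trans_lt (hj l trivial).2
    rw [div_lt_div_iff_of_pos_right hK] at h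
    exact Nat.lt_succ_iff.1 (by exact_mod_cast h)
  exact le_antisymm (hle hi hj) (hle hj hi)

theorem positionLaw_of_subset_region {j : Fin m → Fin M.K} {B : Set (Fin m → ℝ)}
    (hB : B ⊆ M.region j) : M.positionLaw.real B = M.ρ j * volume.real B := by
  have hrestrict : ∀ i, volume.restrict (M.region i) B = if i = j then volume B else 0 := by
    intro i
    rw [Measure.restrict_apply' (M.measurableSet_region i)]
    split_ifs with hij
    · rw [hij, Set.inter_eq_left.2 hB]
    · rw [Set.disjoint_iff_inter_eq_empty.1 (Set.disjoint_left.2 fun y hy hi =>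
        hij (M.eq_of_mem_region hi (hB hy))), measure_empty]
  simp only [measureReal_def, positionLaw, Measure.coe_finsetSum, Finset.sum_apply,
    Measure.smul_apply, hrestrict, smul_eq_mul, mul_ite, mul_zero, Finset.sum_ite_eq',
    Finset.mem_univ, if_true, ENNReal.toReal_mul, ENNReal.toReal_ofReal (M.ρ_nonneg j)]

variable {M} {j : Fin m → Fin M.K} {x y : Fin m → ℝ}

theorem boundaryDist_nonneg : 0 ≤ M.boundaryDist j x :=
  Real.sInf_nonneg (by rintro _ ⟨y, -, rfl⟩; exact apply_nonneg _ _)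

theorem boundaryDist_le (hy : y ∈ frontier (M.region j)) : M.boundaryDist j x ≤ M.N (x - y) :=
  csInf_le ⟨0, by rintro _ ⟨z, -, rfl⟩; exact apply_nonneg _ _⟩ ⟨y, hy, rfl⟩

theorem mem_region_of_N_sub_lt (hx : x ∈ M.region j) (h : M.N (x - y) < M.boundaryDist j x) :
    y ∈ M.region j := by
  refine subset_of_isPreconnected_of_disjoint_frontier (s := segment ℝ x y)
    (convex_segment x y).isPreconnected (Set.disjoint_left.2 fun z hz hzf => ?_)
    ⟨x, left_mem_segment ℝ x y, hx⟩ (right_mem_segment ℝ x y)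
  obtain ⟨θ, ⟨h0, h1⟩, rfl⟩ := (segment_eq_image' ℝ x y ▸ hz :)
  have hdist := boundaryDist_le (x := x) hzf
  rw [show x - (x + θ • (y - x)) = θ • (x - y) by module, map_smul_eq_mul,
    Real.norm_of_nonneg h0] at hdist
  linarith [mul_le_of_le_one_left (apply_nonneg M.N (x - y)) h1]

theorem closedBall_subset_region {r : ℝ} (hx : x ∈ M.region j) (hr : r < M.boundaryDist j x) :
    M.N.closedBall x r ⊆ M.region j := by
  intro y hy
  rw [Seminorm.mem_closedBall, map_sub_rev] at hy
  exact mem_region_of_N_sub_lt hx (hy.trans_lt hr)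

theorem unitBallVolume_mul_boundaryDist_pow_le_one (hx : x ∈ M.region j) :
    M.unitBallVolume * M.boundaryDist j x ^ m ≤ 1 := by
  rcases (boundaryDist_nonneg (j := j) (x := x)).eq_or_lt with hδ | hδ
  · simp [← hδ, M.m_pos.ne']
  have hcont : Continuous fun r : ℝ => M.unitBallVolume * r ^ m := by fun_prop
  refine le_of_tendsto (hcont.continuousWithinAt (s := Set.Iio (M.boundaryDist j x))) ?_
  filter_upwards [Ioo_mem_nhdsLT hδ] with r hr
  rw [← M.volume_closedBall x hr.1.le]
  exact measureReal_le_one_of_subset_cube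
    ((closedBall_subset_region hx hr.2).trans (M.region_subset_cube j))

variable (M) in
theorem torusDist_le_N (x y : Fin m → ℝ) : M.torusDist x y ≤ M.N (x - y) := by
  refine (ciInf_le ⟨0, ?_⟩ (0 : Fin m → ℤ)).trans_eq ?_
  · rintro _ ⟨z, rfl⟩
    exact apply_nonneg _ _
  · simp only [Pi.zero_apply, Int.cast_zero]
    exact congrArg M.N (add_zero _)

theorem eq_zero_of_sub_mem_cube {z : Fin m → ℤ} (hy : y ∈ cube m)
    (hz : (y - fun i => (z i : ℝ)) ∈ cube m) : z = 0 := by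
  funext i
  obtain ⟨h1, h2⟩ := hy i trivial
  obtain ⟨h3, h4⟩ := hz i trivial
  rw [Pi.sub_apply] at h3 h4
  have hlt : z i < 1 := by exact_mod_cast (by linarith : (z i : ℝ) < 1)
  have hgt : -1 < z i := by exact_mod_cast (by linarith : (-1 : ℝ) < z i)
  exact Int.le_antisymm (Int.lt_add_one_iff.1 hlt) hgt

theorem N_sub_lt_of_torusDist_lt {r : ℝ} (hx : x ∈ M.region j) (hr : r ≤ M.boundaryDist j x)
    (hy : y ∈ cube m) (h : M.torusDist x y < r) : M.N (x - y) < r := by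
  obtain ⟨z, hz⟩ := exists_lt_of_ciInf_lt h
  rw [sub_add] at hz
  have hmem := M.region_subset_cube j (mem_region_of_N_sub_lt hx (hz.trans_le hr))
  obtain rfl := eq_zero_of_sub_mem_cube hy hmem
  simpa only [Pi.zero_apply, Int.cast_zero, ← Pi.zero_def, sub_zero] using hz

theorem torusBall_eq_closedBall {r : ℝ} (hx : x ∈ M.region j) (hr : r < M.boundaryDist j x) :
    M.torusBall x r = M.N.closedBall x r := by
  ext y
  constructor
  · rintro ⟨hy, hd⟩
    rw [Seminorm.mem_closedBall, map_sub_rev]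
    refine le_of_forall_gt_imp_ge_of_dense fun r' hr' => ?_
    exact (N_sub_lt_of_torusDist_lt hx (min_le_right r' _) hy
      (hd.trans_lt (lt_min hr' hr))).le.trans (min_le_left _ _)
  · intro hy
    have hyN := hy
    rw [Seminorm.mem_closedBall, map_sub_rev] at hyN
    exact ⟨M.region_subset_cube j (closedBall_subset_region hx hr hy),
      (M.torusDist_le_N x y).trans hyN⟩

theorem ballOfVolume_eq_closedBall {r : ℝ} (hx : x ∈ M.region j) (hr0 : 0 ≤ r)
    (hr : r < M.boundaryDist j x) :
    M.ballOfVolume x (M.unitBallVolume * r ^ m) = M.N.closedBall x r := by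
  have hmono : ∀ {r₁ r₂ : ℝ}, 0 ≤ r₁ → r₁ < r₂ →
      M.unitBallVolume * r₁ ^ m < M.unitBallVolume * r₂ ^ m := fun h0 h =>
    mul_lt_mul_of_pos_left (pow_lt_pow_left₀ h h0 M.m_pos.ne') M.unitBallVolume_pos
  have hvol : ∀ r', 0 ≤ r' → r' < M.boundaryDist j x →
      volume.real (M.torusBall x r') = M.unitBallVolume * r' ^ m := fun r' h0 h1 => by
    rw [torusBall_eq_closedBall hx h1, M.volume_closedBall x h0]
  have hradius : M.ballRadius x (M.unitBallVolume * r ^ m) = r := by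
    refine IsLeast.csInf_eq ⟨⟨hr0, (hvol r hr0 hr).ge⟩, ?_⟩
    rintro r' ⟨h0, h1⟩
    by_contra! hlt
    rw [hvol r' h0 (hlt.trans hr)] at h1
    exact (hmono h0 hlt).not_ge h1
  have hlt : M.unitBallVolume * r ^ m < 1 :=
    (hmono hr0 hr).trans_le (unitBallVolume_mul_boundaryDist_pow_le_one hx)
  rw [ballOfVolume, if_neg hlt.not_ge, hradius, torusBall_eq_closedBall hx hr]

theorem positionLaw_ballOfVolume {V : ℝ} (hx : x ∈ M.region j) (hV : 0 ≤ V)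
    (h : V < M.unitBallVolume * M.boundaryDist j x ^ m) :
    M.positionLaw.real (M.ballOfVolume x V) = M.ρ j * V := by
  have hc := M.unitBallVolume_pos
  obtain ⟨r, hr0, rfl⟩ : ∃ r : ℝ, 0 ≤ r ∧ V = M.unitBallVolume * r ^ m := by
    refine ⟨(V / M.unitBallVolume) ^ (m : ℝ)⁻¹, by positivity, ?_⟩
    rw [Real.rpow_inv_natCast_pow (by positivity) M.m_pos.ne', mul_div_cancel₀ _ hc.ne']
  have hr : r < M.boundaryDist j x :=
    lt_of_pow_lt_pow_left₀ m boundaryDist_nonneg (lt_of_mul_lt_mul_left h hc.le)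
  rw [ballOfVolume_eq_closedBall hx hr0 hr,
    M.positionLaw_of_subset_region (closedBall_subset_region hx hr), M.volume_closedBall x hr0]

end SPAModel

/-! ### Measurability of the spheres of influence -/

theorem measurable_sInf_of_isUpperSet {Ω : Type*} [MeasurableSpace Ω] {S : Ω → Set ℝ}
    (hS : ∀ r, MeasurableSet {x | r ∈ S x}) (hup : ∀ x, IsUpperSet (S x))
    (hbdd : ∀ x, BddBelow (S x)) : Measurable fun x => sInf (S x) := by
  refine measurable_of_Iio fun c => ?_
  have hiff : ∀ x, sInf (S x) < c ↔
      (∃ q : ℚ, (q : ℝ) ∈ S x ∧ (q : ℝ) < c) ∨ (∀ q : ℚ, (q : ℝ) ∉ S x) ∧ 0 < c := by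
    intro x
    rcases (S x).eq_empty_or_nonempty with he | hne
    · simp [he]
    · obtain ⟨r, hr⟩ := hne
      have hrat : ∃ q : ℚ, (q : ℝ) ∈ S x := (exists_rat_gt r).imp fun q hq => hup x hq.le hr
      have hnone : ¬ ∀ q : ℚ, (q : ℝ) ∉ S x := not_forall_not.2 hrat
      rw [csInf_lt_iff (hbdd x) ⟨r, hr⟩]
      simp only [hnone, false_and, or_false]
      refine ⟨fun ⟨r, hr, hrc⟩ => ?_, fun ⟨q, hq⟩ => ⟨q, hq⟩⟩
      obtain ⟨q, hrq, hqc⟩ := exists_rat_btwn hrc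
      exact ⟨q, hup x hrq.le hr, hqc⟩
  have hset : (fun x => sInf (S x)) ⁻¹' Set.Iio c =
      (⋃ q : ℚ, {x | (q : ℝ) ∈ S x} ∩ {_x | (q : ℝ) < c}) ∪
        (⋂ q : ℚ, {x | (q : ℝ) ∈ S x}ᶜ) ∩ {_x | 0 < c} := by
    ext x
    simpa using hiff x
  rw [hset]
  exact (MeasurableSet.iUnion fun q : ℚ => (hS q).inter (.const _)).union
    ((MeasurableSet.iInter fun q : ℚ => (hS q).compl).inter (.const _))

namespace SPAModel

variable {m : ℕ} (M : SPAModel m)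

theorem measurable_torusDist :
    Measurable fun q : (Fin m → ℝ) × (Fin m → ℝ) => M.torusDist q.1 q.2 :=
  Measurable.iInf fun _ => (M.continuous_N.comp (by fun_prop)).measurable

theorem measurableSet_torusBall_graph {f : (Fin m → ℝ) → ℝ} (hf : Measurable f) :
    MeasurableSet {q : (Fin m → ℝ) × (Fin m → ℝ) | q.2 ∈ M.torusBall q.1 (f q.1)} :=
  (measurable_snd measurableSet_cube).inter
    (measurableSet_le M.measurable_torusDist (hf.comp measurable_fst))

theorem measurable_volume_torusBall (r : ℝ) :
    Measurable fun x => volume.real (M.torusBall x r) :=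
  (measurable_measure_prodMk_left (M.measurableSet_torusBall_graph measurable_const)).ennreal_toReal

theorem volume_torusBall_mono (x : Fin m → ℝ) : Monotone fun r => volume.real (M.torusBall x r) :=
  fun _ _ h => measureReal_mono (fun _ hy => ⟨hy.1, hy.2.trans h⟩)
    (measure_ne_top_of_subset (fun _ hy => hy.1) (by simp [volume_cube]))

theorem measurable_ballRadius (V : ℝ) : Measurable fun x => M.ballRadius x V := by
  refine measurable_sInf_of_isUpperSet (fun r => ?_) (fun x r r' h hr => ?_)
    fun x => ⟨0, fun r hr => hr.1⟩
  · exact (MeasurableSet.const _).inter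
      (measurableSet_le measurable_const (M.measurable_volume_torusBall r))
  · exact ⟨hr.1.trans h, hr.2.trans (M.volume_torusBall_mono x h)⟩

theorem measurableSet_sphere_graph (d t : ℕ) :
    MeasurableSet {q : (Fin m → ℝ) × (Fin m → ℝ) | q.2 ∈ M.sphere q.1 d t} := by
  unfold sphere ballOfVolume
  split_ifs
  · exact measurable_snd measurableSet_cube
  · exact M.measurableSet_torusBall_graph (M.measurable_ballRadius _)

/-! ### The evolution of one in-degree -/

/-- The event that `v_(u+1)` links to `v_s`, as a set of values of the position and the coins of
`v_(u+1)`, the history `ξ` up to time `u` being given. -/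
def linkSet (s u : ℕ) (ξ : Outcome m) : Set ((Fin m → ℝ) × (ℕ → Bool)) :=
  M.sphere (pos ξ s) (M.deg ξ s u) u ×ˢ {b | b s = true}

open Classical in
theorem snd_lt_fst_of_mem_edges {ξ : Outcome m} {t : ℕ} {e : ℕ × ℕ} (he : e ∈ M.edges ξ t) :
    e.2 < e.1 ∧ e.1 ≤ t := by
  induction t with
  | zero => simp [edges] at he
  | succ t ih =>
    rw [edges, Finset.mem_union, Finset.mem_image] at he
    rcases he with he | ⟨s, hs, rfl⟩
    · exact (ih he).imp_right Nat.le_succ_of_le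
    · exact ⟨Nat.lt_succ_of_le (Finset.mem_Icc.1 (Finset.mem_filter.1 hs).1).2, le_rfl⟩

theorem deg_eq_zero (ξ : Outcome m) {s t : ℕ} (h : t ≤ s) : M.deg ξ s t = 0 := by
  rw [deg, inDegree, Finset.card_eq_zero, Finset.filter_eq_empty_iff]
  rintro e he rfl
  have := M.snd_lt_fst_of_mem_edges he
  lia

open Classical in
theorem deg_succ (ξ : Outcome m) {s u : ℕ} (hs : 1 ≤ s) (hsu : s ≤ u) :
    M.deg ξ s (u + 1) = M.deg ξ s u + if ξ (u + 1) ∈ M.linkSet s u ξ then 1 else 0 := by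
  have hnew : ∀ r : ℕ, (u + 1, r) ∉ M.edges ξ u := fun r hr => by
    have := (M.snd_lt_fst_of_mem_edges hr).2
    lia
  rw [deg, inDegree, edges, Finset.filter_union, Finset.card_union_of_disjoint, Finset.filter_image,
    Finset.card_image_of_injective _ (Prod.mk_right_injective _), Finset.filter_filter]
  · congr 1
    by_cases h : ξ (u + 1) ∈ M.linkSet s u ξ
    · rw [if_pos h, Finset.card_eq_one]
      refine ⟨s, Finset.ext fun r => ?_⟩
      rw [Finset.mem_filter, Finset.mem_singleton]
      exact ⟨fun hr => hr.2.2, by rintro rfl; exact ⟨Finset.mem_Icc.2 ⟨hs, hsu⟩, h, rfl⟩⟩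
    · rw [if_neg h, Finset.card_eq_zero, Finset.filter_eq_empty_iff]
      rintro r - ⟨hr, rfl⟩
      exact h hr
  · refine Finset.disjoint_filter_filter (Finset.disjoint_right.2 fun e he => ?_)
    obtain ⟨r, -, rfl⟩ := Finset.mem_image.1 he
    exact hnew r

theorem deg_succ' (ξ : Outcome m) {s u : ℕ} (hs : 1 ≤ s) (hsu : s ≤ u) :
    (M.deg ξ s (u + 1) : ℝ) = M.deg ξ s u + (M.linkSet s u ξ).indicator 1 (ξ (u + 1)) := by
  classical
  rw [M.deg_succ ξ hs hsu, Set.indicator_apply]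
  push_cast
  rfl

open Classical in
theorem dependsOn_edges (t : ℕ) : DependsOn (fun ξ => M.edges ξ t) (Set.Iic t) := by
  induction t with
  | zero => exact fun _ _ _ => rfl
  | succ t ih =>
    intro ξ ξ' h
    have hpast : M.edges ξ t = M.edges ξ' t :=
      ih fun i hi => h i (Set.Iic_subset_Iic.2 t.le_succ hi)
    simp only [edges]
    rw [hpast]
    congr 2
    refine Finset.filter_congr fun s hs => ?_
    have hs' : s ∈ Set.Iic (t + 1) := Nat.le_succ_of_le (Finset.mem_Icc.1 hs).2
    rw [pos, pos, coin, pos, pos, coin, h _ hs', h _ (Set.mem_Iic.2 le_rfl)]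

theorem dependsOn_linkSet {s u : ℕ} (hsu : s ≤ u) : DependsOn (M.linkSet s u) (Set.Iic u) := by
  intro ξ ξ' h
  have hedges : M.edges ξ u = M.edges ξ' u := M.dependsOn_edges u h
  rw [linkSet, linkSet, deg, deg, hedges, pos, pos, h s hsu]

theorem measurableSet_linkSet_graph_of_measurable_deg {s u : ℕ}
    (hdeg : Measurable fun ξ => M.deg ξ s u) :
    MeasurableSet {q : Outcome m × ((Fin m → ℝ) × (ℕ → Bool)) | q.2 ∈ M.linkSet s u q.1} := by
  have hset : {q : Outcome m × ((Fin m → ℝ) × (ℕ → Bool)) | q.2 ∈ M.linkSet s u q.1} =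
      (⋃ d : ℕ, {q | M.deg q.1 s u = d} ∩ {q | q.2.1 ∈ M.sphere (pos q.1 s) d u}) ∩
        {q | q.2.2 s = true} := by
    ext q
    simp [linkSet]
  have hpos : Measurable fun q : Outcome m × ((Fin m → ℝ) × (ℕ → Bool)) => (pos q.1 s, q.2.1) := by
    unfold pos
    fun_prop
  have hcoin : Measurable fun q : Outcome m × ((Fin m → ℝ) × (ℕ → Bool)) => q.2.2 s := by
    fun_prop
  rw [hset]
  refine (MeasurableSet.iUnion fun d => ?_).inter (hcoin (measurableSet_singleton true))
  exact ((hdeg.comp measurable_fst) (measurableSet_singleton d)).inter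
    (hpos (M.measurableSet_sphere_graph d u))

theorem measurable_deg {s : ℕ} (hs : 1 ≤ s) (t : ℕ) : Measurable fun ξ => M.deg ξ s t := by
  induction t with
  | zero => simp only [M.deg_eq_zero _ (Nat.zero_le s), measurable_const]
  | succ t ih =>
    rcases lt_or_ge t s with hts | hst
    · simp only [M.deg_eq_zero _ (Nat.succ_le_of_lt hts), measurable_const]
    · simp only [M.deg_succ _ hs hst]
      refine ih.add (.ite ?_ measurable_const measurable_const)
      exact (measurable_id.prodMk (measurable_pi_apply (t + 1)))
        (M.measurableSet_linkSet_graph_of_measurable_deg ih)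

theorem measurableSet_linkSet_graph {s : ℕ} (hs : 1 ≤ s) (u : ℕ) :
    MeasurableSet {q : Outcome m × ((Fin m → ℝ) × (ℕ → Bool)) | q.2 ∈ M.linkSet s u q.1} :=
  M.measurableSet_linkSet_graph_of_measurable_deg (M.measurable_deg hs u)

/-- The law of the position and the coins of one node. -/
def nodeLaw : Measure ((Fin m → ℝ) × (ℕ → Bool)) :=
  M.positionLaw.prod (Measure.infinitePi fun _ => M.coinLaw)

instance : IsProbabilityMeasure M.nodeLaw := by
  unfold nodeLaw
  infer_instance

theorem coinLaw_true : M.coinLaw {true} = ENNReal.ofReal M.p := by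
  rw [coinLaw, ProbabilityTheory.bernoulliMeasure_apply_of_mem_of_notMem _
    (measurableSet_singleton _) (by simp) (by simp)]
  exact congrArg _ (Real.toNNReal_of_nonneg M.p_pos.le).symm

theorem nodeLaw_linkSet (s u : ℕ) (ξ : Outcome m) :
    M.nodeLaw.real (M.linkSet s u ξ) =
      M.p * M.positionLaw.real (M.sphere (pos ξ s) (M.deg ξ s u) u) := by
  have hcoin : (Measure.infinitePi fun _ : ℕ => M.coinLaw) {b | b s = true} =
      ENNReal.ofReal M.p := by
    rw [← M.coinLaw_true]
    exact (measurePreserving_eval_infinitePi (fun _ : ℕ => M.coinLaw) s).measure_preimage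
      (measurableSet_singleton true).nullMeasurableSet
  rw [measureReal_def, nodeLaw, linkSet, Measure.prod_prod, hcoin, ENNReal.toReal_mul,
    ENNReal.toReal_ofReal M.p_pos.le, mul_comm, measureReal_def]

end SPAModel

/-! ### Consequences of `T_v ≤ t` and `t_v ≤ t` -/

namespace SPAModel

variable {m : ℕ} (M : SPAModel m)

/-- The exponent `p ρ A₁` of the growth of in-degrees in the region with index `j`. -/
def exponent (j : Fin m → Fin M.K) : ℝ := M.p * M.ρ j * M.A₁

/-- The prediction `k (t / n) ^ (p ρ A₁)` for the in-degree at time `t`, extrapolated from the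
in-degree `k` at time `n`. -/
def predictedDeg (j : Fin m → Fin M.K) (n k t : ℕ) : ℝ := k * ((t : ℝ) / n) ^ M.exponent j

variable {j : Fin m → Fin M.K} {ε δ w : ℝ} {n k t : ℕ}

theorem exponent_nonneg (j : Fin m → Fin M.K) : 0 ≤ M.exponent j :=
  mul_nonneg (mul_nonneg M.p_pos.le (M.ρ_nonneg j)) M.A₁_pos.le

theorem exponent_lt_one (j : Fin m → Fin M.K) : M.exponent j < 1 := by
  rw [exponent, mul_right_comm]
  exact M.subcritical j

theorem le_predictedDeg_of_timeT_le (hn : 0 < n) (hk : 0 < k) (hw : 0 ≤ w * Real.log n)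
    (hwk : w * Real.log n ≤ k) (hT : M.timeT j w n k ≤ t) :
    w * Real.log n ≤ M.predictedDeg j n k t := by
  have hn' : (0 : ℝ) < n := by exact_mod_cast hn
  have hk' : (0 : ℝ) < k := by exact_mod_cast hk
  rw [predictedDeg]
  rcases (M.exponent_nonneg j).eq_or_lt with hα | hα
  · rwa [← hα, Real.rpow_zero, mul_one]
  · have hpow : (w * Real.log n / k) ^ (1 / M.exponent j) ≤ (t : ℝ) / n := (le_div_iff₀' hn').2 hT
    rw [one_div, Real.rpow_inv_le_iff_of_pos (by positivity) (by positivity) hα,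
      div_le_iff₀' hk'] at hpow
    exact hpow

theorem predictedDeg_le_of_timet_le (hε : 0 < ε) (hδ : 0 < δ) (hn : 0 < n) (hk : 0 < k)
    (ht : M.timet j ε δ n k ≤ t) :
    M.A₁ * M.predictedDeg j n k t * (1 + ε) ^ (1 - M.exponent j) ≤
      t * (M.unitBallVolume * δ ^ m) := by
  have hA := M.A₁_pos
  have hc := M.unitBallVolume_pos
  have hn' : (0 : ℝ) < n := by exact_mod_cast hn
  have : (0 : ℝ) < k := by exact_mod_cast hk
  have ht' : (0 : ℝ) < t := lt_of_lt_of_le (by unfold timet; positivity) ht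
  have hα : 0 < 1 - M.exponent j := sub_pos.2 (M.exponent_lt_one j)
  have hpow : (M.A₁ * k / (δ ^ m * M.unitBallVolume * (n : ℝ) ^ M.exponent j)) ^
      (1 / (1 - M.exponent j)) ≤ t / (1 + ε) := (le_div_iff₀' (by positivity)).2 ht
  rw [one_div, Real.rpow_inv_le_iff_of_pos (by positivity) (by positivity) hα,
    Real.div_rpow ht'.le (by positivity), div_le_div_iff₀ (by positivity) (by positivity)] at hpow
  calc M.A₁ * M.predictedDeg j n k t * (1 + ε) ^ (1 - M.exponent j)
      = M.A₁ * k * (1 + ε) ^ (1 - M.exponent j) *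
          ((t : ℝ) ^ M.exponent j / (n : ℝ) ^ M.exponent j) := by
        rw [predictedDeg, Real.div_rpow ht'.le hn'.le]
        ring
    _ ≤ (t : ℝ) ^ (1 - M.exponent j) * (δ ^ m * M.unitBallVolume * (n : ℝ) ^ M.exponent j) *
          ((t : ℝ) ^ M.exponent j / (n : ℝ) ^ M.exponent j) := by gcongr
    _ = (t : ℝ) ^ (1 - M.exponent j) * (t : ℝ) ^ M.exponent j * (M.unitBallVolume * δ ^ m) := by
        field_simp
    _ = t * (M.unitBallVolume * δ ^ m) := by
        rw [← Real.rpow_add ht', sub_add_cancel, Real.rpow_one]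

/-! ### Extrapolating an in-degree back in time -/

/-- The relative error of the prediction, in terms of the value `w` of `ω`. -/
def relError (w : ℝ) : ℝ := 10 * (√w)⁻¹ + (2 * (M.A₂ / M.A₁) + 1 / M.A₁) / w

/-- The value `w` of `ω` is so large that the prediction is meaningful and that, after the time
`t_v`, the factor `1 + ε` in the definition of `t_v` absorbs all errors, which keeps the sphere of
influence of `v` inside its region. -/
structure LargeEnough (ε w : ℝ) : Prop where
  pos : 0 < w
  relError_lt_one : M.relError w < 1
  slack : ∀ j, (1 + 10 * (√w)⁻¹) * ((1 + 1 / (M.A₁ * w)) * (1 + M.A₂ / M.A₁ / w)) <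
    (1 + ε) ^ (1 - M.exponent j)

theorem tendsto_relError : Tendsto M.relError atTop (𝓝 0) := by
  have hlim := (Real.tendsto_sqrt_atTop.inv_tendsto_atTop.const_mul 10).add
    (tendsto_id.const_div_atTop (2 * (M.A₂ / M.A₁) + 1 / M.A₁))
  rwa [mul_zero, add_zero] at hlim

theorem eventually_largeEnough (hε : 0 < ε) : ∀ᶠ w in atTop, M.LargeEnough ε w := by
  have hslack : ∀ j, ∀ᶠ w in atTop, (1 + 10 * (√w)⁻¹) *
      ((1 + 1 / (M.A₁ * w)) * (1 + M.A₂ / M.A₁ / w)) < (1 + ε) ^ (1 - M.exponent j) := by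
    intro j
    have hlim : Tendsto (fun w => (1 + 10 * (√w)⁻¹) *
        ((1 + 1 / (M.A₁ * w)) * (1 + M.A₂ / M.A₁ / w))) atTop
        (𝓝 ((1 + 10 * 0) * ((1 + 0) * (1 + 0)))) :=
      ((Real.tendsto_sqrt_atTop.inv_tendsto_atTop.const_mul 10).const_add 1).mul
        ((((tendsto_id.const_mul_atTop M.A₁_pos).const_div_atTop 1).const_add 1).mul
          ((tendsto_id.const_div_atTop _).const_add 1))
    refine hlim.eventually_lt_const ?_
    simpa using Real.one_lt_rpow (lt_add_of_pos_right 1 hε) (sub_pos.2 (M.exponent_lt_one j))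
  filter_upwards [eventually_gt_atTop 0, M.tendsto_relError.eventually_lt_const one_pos,
    eventually_all.2 hslack] with w hpos herr hslack
  exact ⟨hpos, herr, hslack⟩

variable {M}

theorem LargeEnough.ten_mul_inv_sqrt_lt_one (h : M.LargeEnough ε w) : 10 * (√w)⁻¹ < 1 := by
  have hw := h.pos
  have hA₁ := M.A₁_pos
  have hA₂ := M.A₂_pos
  have hrest : 0 ≤ (2 * (M.A₂ / M.A₁) + 1 / M.A₁) / w := by positivity
  have herr := h.relError_lt_one
  rw [relError] at herr
  linarith

theorem LargeEnough.one_le (h : M.LargeEnough ε w) : 1 ≤ w := by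
  have := h.ten_mul_inv_sqrt_lt_one
  rw [← div_eq_mul_inv, div_lt_one (Real.sqrt_pos.2 h.pos)] at this
  exact Real.one_le_sqrt.1 (by linarith)

theorem LargeEnough.abs_inv_sqrt_le_one (h : M.LargeEnough ε w) : |(√w)⁻¹| ≤ 1 := by
  rw [abs_of_nonneg (by positivity)]
  exact inv_le_one_of_one_le₀ (Real.one_le_sqrt.2 h.one_le)

theorem LargeEnough.one_lt_mul (h : M.LargeEnough ε w) : 1 < M.A₁ * w := by
  have hw := h.pos
  have hA₁ := M.A₁_pos
  have hA₂ := M.A₂_pos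
  have hsplit : M.relError w = 10 * (√w)⁻¹ + 2 * (M.A₂ / M.A₁) / w + 1 / (M.A₁ * w) := by
    rw [relError]
    field_simp
    ring
  have : 0 ≤ 10 * (√w)⁻¹ + 2 * (M.A₂ / M.A₁) / w := by positivity
  rw [← div_lt_one (by positivity)]
  linarith [h.relError_lt_one]

variable (M) in
/-- The conditions under which the in-degree at time `t` of a node in the region with index `j` is
extrapolated from its in-degree `k` at time `n`; `δ` is the distance to the boundary. -/
structure Predictable (j : Fin m → Fin M.K) (ε w δ : ℝ) (n k t : ℕ) : Prop where
  dist_pos : 0 < δ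
  one_le_log : 1 ≤ Real.log n
  sq_mul_log_le_finalDeg : w ^ 2 * Real.log n ≤ k
  timet_le : M.timet j ε δ n k ≤ t
  timeT_le : M.timeT j w n k ≤ t

namespace Predictable

variable (h : M.Predictable j ε w δ n k t)
include h

theorem mono {u : ℕ} (htu : t ≤ u) : M.Predictable j ε w δ n k u where
  __ := h
  timet_le := h.timet_le.trans (Nat.cast_le.2 htu)
  timeT_le := h.timeT_le.trans (Nat.cast_le.2 htu)

theorem finalTime_pos : 0 < n := by
  refine Nat.pos_of_ne_zero ?_
  rintro rfl
  have := h.one_le_log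
  norm_num at this

variable (hw : M.LargeEnough ε w)
include hw

theorem mul_log_le_finalDeg : w * Real.log n ≤ k := by
  have hlog := h.one_le_log
  refine le_trans ?_ h.sq_mul_log_le_finalDeg
  gcongr
  exact le_self_pow₀ hw.one_le two_ne_zero

theorem le_finalDeg : w ≤ k :=
  (le_mul_of_one_le_right hw.pos.le h.one_le_log).trans (h.mul_log_le_finalDeg hw)

theorem finalDeg_pos : 0 < k := by
  exact_mod_cast hw.pos.trans_le (h.le_finalDeg hw)

theorem mul_log_le_predictedDeg : w * Real.log n ≤ M.predictedDeg j n k t :=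
  M.le_predictedDeg_of_timeT_le h.finalTime_pos (h.finalDeg_pos hw)
    (mul_nonneg hw.pos.le (zero_le_one.trans h.one_le_log)) (h.mul_log_le_finalDeg hw) h.timeT_le

theorem le_predictedDeg : w ≤ M.predictedDeg j n k t :=
  (le_mul_of_one_le_right hw.pos.le h.one_le_log).trans (h.mul_log_le_predictedDeg hw)

theorem predictedDeg_pos : 0 < M.predictedDeg j n k t :=
  hw.pos.trans_le (h.le_predictedDeg hw)

theorem le_div_mul_predictedDeg {b : ℝ} (hb : 0 ≤ b) : b ≤ b / w * M.predictedDeg j n k t := by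
  rw [div_mul_eq_mul_div, le_div_iff₀ hw.pos]
  exact mul_le_mul_of_nonneg_left (h.le_predictedDeg hw) hb

variable (hε : 0 < ε)
include hε

theorem predictedDeg_le : M.A₁ * M.predictedDeg j n k t * (1 + ε) ^ (1 - M.exponent j) ≤
    t * (M.unitBallVolume * δ ^ m) :=
  M.predictedDeg_le_of_timet_le hε h.dist_pos h.finalTime_pos (h.finalDeg_pos hw) h.timet_le

variable (hδ : M.unitBallVolume * δ ^ m ≤ 1)
include hδ

theorem mul_le_time : M.A₁ * w ≤ t := by
  have hA := M.A₁_pos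
  have hx := h.predictedDeg_pos hw
  calc M.A₁ * w ≤ M.A₁ * M.predictedDeg j n k t * 1 := by
        rw [mul_one]
        exact mul_le_mul_of_nonneg_left (h.le_predictedDeg hw) hA.le
    _ ≤ M.A₁ * M.predictedDeg j n k t * (1 + ε) ^ (1 - M.exponent j) := by
        gcongr
        exact Real.one_le_rpow (by linarith) (sub_nonneg.2 (M.exponent_lt_one j).le)
    _ ≤ t * (M.unitBallVolume * δ ^ m) := h.predictedDeg_le hw hε
    _ ≤ t := mul_le_of_le_one_right (Nat.cast_nonneg t) hδ

theorem two_le_time : 2 ≤ t := by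
  exact_mod_cast hw.one_lt_mul.trans_le (h.mul_le_time hw hε hδ)

theorem add_div_growth_succ_le (htn : t < n) :
    (k + M.A₂ / M.A₁) / growth (M.exponent j) (t + 1) n ≤
      (1 + 1 / (M.A₁ * w)) * ((1 + M.A₂ / M.A₁ / w) * M.predictedDeg j n k t) := by
  have hA₁ := M.A₁_pos
  have hA₂ := M.A₂_pos
  have hw0 := hw.pos
  have hα := M.exponent_nonneg j
  have ht : (0 : ℝ) < t := by exact_mod_cast two_pos.trans_le (h.two_le_time hw hε hδ)
  have hg : 0 < growth (M.exponent j) (t + 1) n := growth_pos hα _ _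
  have hstep : growth (M.exponent j) t n =
      (1 + M.exponent j / t) * growth (M.exponent j) (t + 1) n := by
    rw [← growth_mul_growth _ t.le_succ htn, growth_succ _ le_rfl, growth_self, one_mul]
  calc (k + M.A₂ / M.A₁) / growth (M.exponent j) (t + 1) n
      = (1 + M.exponent j / t) * ((k + M.A₂ / M.A₁) / growth (M.exponent j) t n) := by
        rw [hstep]
        have : 0 < 1 + M.exponent j / t := by positivity
        field_simp
    _ ≤ (1 + 1 / (M.A₁ * w)) * (M.predictedDeg j n k t + M.A₂ / M.A₁) := by
        gcongr
        · exact div_nonneg (by positivity) (growth_pos hα _ _).le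
        · exact (M.exponent_lt_one j).le
        · exact h.mul_le_time hw hε hδ
        · exact add_div_growth_le hα (M.exponent_lt_one j).le htn.le (by exact_mod_cast ht)
            (Nat.cast_nonneg k) (by positivity)
    _ ≤ (1 + 1 / (M.A₁ * w)) * ((1 + M.A₂ / M.A₁ / w) * M.predictedDeg j n k t) := by
        rw [one_add_mul (M.A₂ / M.A₁ / w)]
        gcongr
        exact h.le_div_mul_predictedDeg hw (by positivity)

theorem volume_lt (htn : t < n) {d : ℝ}
    (hd : d + M.A₂ / M.A₁ ≤ (1 + 10 * (√w)⁻¹) *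
      ((k + M.A₂ / M.A₁) / growth (M.exponent j) (t + 1) n)) :
    (M.A₁ * d + M.A₂) / t < M.unitBallVolume * δ ^ m := by
  have hA := M.A₁_pos
  have hw0 := hw.pos
  have hx := h.predictedDeg_pos hw
  have ht : (0 : ℝ) < t := by exact_mod_cast two_pos.trans_le (h.two_le_time hw hε hδ)
  rw [div_lt_iff₀' ht]
  calc M.A₁ * d + M.A₂ = M.A₁ * (d + M.A₂ / M.A₁) := by field_simp
    _ ≤ M.A₁ * ((1 + 10 * (√w)⁻¹) * ((1 + 1 / (M.A₁ * w)) *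
          ((1 + M.A₂ / M.A₁ / w) * M.predictedDeg j n k t))) := by
        gcongr
        refine hd.trans ?_
        gcongr
        exact h.add_div_growth_succ_le hw hε hδ htn
    _ = M.A₁ * M.predictedDeg j n k t * ((1 + 10 * (√w)⁻¹) * ((1 + 1 / (M.A₁ * w)) *
          (1 + M.A₂ / M.A₁ / w))) := by ring
    _ < M.A₁ * M.predictedDeg j n k t * (1 + ε) ^ (1 - M.exponent j) :=
        mul_lt_mul_of_pos_left (hw.slack j) (mul_pos hA hx)
    _ ≤ t * (M.unitBallVolume * δ ^ m) := h.predictedDeg_le hw hε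

theorem four_mul_log_le (htn : t ≤ n) :
    4 * Real.log n ≤
      8 * (√w)⁻¹ ^ 2 * ((k + M.A₂ / M.A₁) / growth (M.exponent j) t n) := by
  have hw0 := hw.pos
  have hx := h.predictedDeg_pos hw
  have ht := h.two_le_time hw hε hδ
  have hhalf : 1 / (t : ℝ) ≤ 1 / 2 := one_div_le_one_div_of_le two_pos (by exact_mod_cast ht)
  rw [inv_pow, Real.sq_sqrt hw0.le]
  calc 4 * Real.log n = 8 * w⁻¹ * (w * Real.log n * (1 - 1 / 2)) := by
        field_simp
        ring
    _ ≤ 8 * w⁻¹ * (M.predictedDeg j n k t * (1 - 1 / t)) := by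
        gcongr
        exact h.mul_log_le_predictedDeg hw
    _ ≤ 8 * w⁻¹ * ((k + M.A₂ / M.A₁) / growth (M.exponent j) t n) := by
        gcongr
        exact le_add_div_growth (M.exponent_nonneg j) (M.exponent_lt_one j).le htn ht
          (Nat.cast_nonneg k) (div_pos M.A₂_pos M.A₁_pos).le

end Predictable

end SPAModel

/-! ### Concentration -/

namespace SPAModel

variable {m : ℕ} (M : SPAModel m)

/-- All the exponential supermartingales that control the in-degrees stay below `4 log n`. -/
def DeviationsBounded (ξ : Outcome m) (n : ℕ) (θ : ℝ) : Prop :=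
  ∀ s ∈ Finset.Icc 1 n, ∀ t ∈ Finset.Icc s n, ∀ j, ∀ τ ∈ ({θ, -θ} : Finset ℝ),
    compensatedSum (fun _ => M.nodeLaw) (M.linkSet s)
      (fun u => τ / growth (M.exponent j) t (u + 1)) t n ξ < 4 * Real.log n

theorem prob_four_mul_log_le_compensatedSum_le {s t n : ℕ} (hs : 1 ≤ s) (hst : s ≤ t) (hn : 1 ≤ n)
    (j : Fin m → Fin M.K) {τ : ℝ} (hτ : |τ| ≤ 1) :
    M.prob.real {ξ | 4 * Real.log n ≤ compensatedSum (fun _ => M.nodeLaw) (M.linkSet s)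
      (fun u => τ / growth (M.exponent j) t (u + 1)) t n ξ} ≤ ((n : ℝ) ^ 4)⁻¹ := by
  have hn' : (0 : ℝ) < n := by exact_mod_cast hn
  have hexp : Real.exp (-(4 * Real.log n)) = ((n : ℝ) ^ 4)⁻¹ := by
    rw [Real.exp_neg, mul_comm, Real.exp_mul, Real.exp_log hn']
    norm_cast
  rw [← hexp]
  refine measureReal_le_compensatedSum_le (fun _ => M.nodeLaw) (M.measurableSet_linkSet_graph hs)
    (fun u => ?_) (fun u hu => M.dependsOn_linkSet (hst.trans hu)) n _
  have hg := one_le_growth (M.exponent_nonneg j) t (u + 1)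
  rw [abs_div, abs_of_pos (one_pos.trans_le hg)]
  exact div_le_one_of_le₀ (hτ.trans hg) (zero_le_one.trans hg)

theorem prob_not_deviationsBounded_le {n : ℕ} (hn : 1 ≤ n) {θ : ℝ} (hθ : |θ| ≤ 1) :
    M.prob.real {ξ | ¬ M.DeviationsBounded ξ n θ} ≤
      2 * Fintype.card (Fin m → Fin M.K) * ((n : ℝ) ^ 2)⁻¹ := by
  have : (0 : ℝ) < n := by exact_mod_cast hn
  let P : Finset (((_ : ℕ) × ℕ) × (Fin m → Fin M.K) × ℝ) :=
    ((Finset.Icc 1 n).sigma fun s => Finset.Icc s n) ×ˢ Finset.univ ×ˢ {θ, -θ}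
  let F : ((_ : ℕ) × ℕ) × (Fin m → Fin M.K) × ℝ → Set (Outcome m) := fun q =>
    {ξ | 4 * Real.log n ≤ compensatedSum (fun _ => M.nodeLaw) (M.linkSet q.1.1)
      (fun u => q.2.2 / growth (M.exponent q.2.1) q.1.2 (u + 1)) q.1.2 n ξ}
  have hcover : {ξ | ¬ M.DeviationsBounded ξ n θ} ⊆ ⋃ q ∈ P, F q := by
    intro ξ hξ
    simp only [DeviationsBounded, Set.mem_ofPred_eq, not_forall, not_lt] at hξ
    obtain ⟨s, hs, t, ht, j, τ, hτ, h⟩ := hξ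
    have hmem : (⟨⟨s, t⟩, j, τ⟩ : ((_ : ℕ) × ℕ) × (Fin m → Fin M.K) × ℝ) ∈ P :=
      Finset.mk_mem_product (Finset.mem_sigma.2 ⟨hs, ht⟩)
        (Finset.mk_mem_product (Finset.mem_univ j) hτ)
    exact Set.mem_biUnion (Finset.mem_coe.2 hmem) (Set.mem_ofPred.2 h)
  have hF : ∀ q ∈ P, M.prob.real (F q) ≤ ((n : ℝ) ^ 4)⁻¹ := by
    rintro ⟨⟨s, t⟩, j, τ⟩ hq
    obtain ⟨hst, hjτ⟩ := Finset.mem_product.1 hq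
    obtain ⟨hs, ht⟩ := Finset.mem_sigma.1 hst
    have hτ : |τ| = |θ| := abs_eq_abs.2 (by simpa using (Finset.mem_product.1 hjτ).2)
    exact M.prob_four_mul_log_le_compensatedSum_le (Finset.mem_Icc.1 hs).1 (Finset.mem_Icc.1 ht).1
      hn j (hτ.trans_le hθ)
  have hcard : P.card ≤ n * n * (Fintype.card (Fin m → Fin M.K) * 2) := by
    rw [Finset.card_product, Finset.card_product, Finset.card_sigma, Finset.card_univ]
    gcongr
    · refine (Finset.sum_le_card_nsmul _ _ n fun s hs => ?_).trans_eq (by simp)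
      have := (Finset.mem_Icc.1 hs).1
      rw [Nat.card_Icc]
      lia
    · exact Finset.card_le_two
  calc M.prob.real {ξ | ¬ M.DeviationsBounded ξ n θ}
      ≤ ∑ q ∈ P, M.prob.real (F q) :=
        (measureReal_mono hcover (measure_ne_top _ _)).trans (measureReal_biUnion_finset_le _ _)
    _ ≤ P.card * ((n : ℝ) ^ 4)⁻¹ := by
        rw [← nsmul_eq_mul]
        exact Finset.sum_le_card_nsmul _ _ _ hF
    _ ≤ (n * n * (Fintype.card (Fin m → Fin M.K) * 2)) * ((n : ℝ) ^ 4)⁻¹ := by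
        gcongr
        exact_mod_cast hcard
    _ = 2 * Fintype.card (Fin m → Fin M.K) * ((n : ℝ) ^ 2)⁻¹ := by
        field_simp

variable {M} {j : Fin m → Fin M.K} {ξ : Outcome m} {ε w : ℝ} {n s t : ℕ}

theorem nodeLaw_linkSet_of_lt {u : ℕ} (hx : pos ξ s ∈ M.region j)
    (hV : (M.A₁ * M.deg ξ s u + M.A₂) / u <
      M.unitBallVolume * M.boundaryDist j (pos ξ s) ^ m) :
    M.nodeLaw.real (M.linkSet s u ξ) =
      M.exponent j / u * (M.deg ξ s u + M.A₂ / M.A₁) := by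
  have hA₁ := M.A₁_pos
  have hA₂ := M.A₂_pos
  rw [nodeLaw_linkSet, sphere, M.positionLaw_ballOfVolume hx (by positivity) hV, exponent]
  field_simp

variable (hx : pos ξ s ∈ M.region j) (hs : 1 ≤ s) (hε : 0 < ε) (hw : M.LargeEnough ε w)
  (hdev : M.DeviationsBounded ξ n (√w)⁻¹) (hst : s ≤ t) (htn : t ≤ n)
  (h : M.Predictable j ε w (M.boundaryDist j (pos ξ s)) n (M.deg ξ s n) t)
include hx hs hε hw hdev hst htn h

theorem abs_deg_add_sub_div_growth_le :
    |M.deg ξ s t + M.A₂ / M.A₁ - (M.deg ξ s n + M.A₂ / M.A₁) / growth (M.exponent j) t n| ≤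
      10 * (√w)⁻¹ * ((M.deg ξ s n + M.A₂ / M.A₁) / growth (M.exponent j) t n) := by
  have hA₁ := M.A₁_pos
  have hA₂ := M.A₂_pos
  have hδ := M.unitBallVolume_mul_boundaryDist_pow_le_one hx
  refine abs_sub_div_growth_le_of_drift (M.exponent_nonneg j)
    (Y := fun u => M.deg ξ s u + M.A₂ / M.A₁)
    (I := fun u => (M.linkSet s u ξ).indicator 1 (ξ (u + 1)))
    (q := fun u => M.nodeLaw.real (M.linkSet s u ξ)) (L := 4 * Real.log n)
    (inv_pos.2 (Real.sqrt_pos.2 hw.pos)) hw.ten_mul_inv_sqrt_lt_one.le (by positivity)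
    (fun u hu => ?_) (fun u _ => Set.indicator_nonneg (fun _ _ => zero_le_one) _)
    (fun u hu hYu => ?_) (fun u hu => ?_) (fun u hu τ hτ => ?_) le_rfl htn
  · rw [M.deg_succ' ξ hs (hst.trans (Finset.mem_Ico.1 hu).1)]
    ring
  · rw [Finset.mem_Ico] at hu
    exact nodeLaw_linkSet_of_lt hx ((h.mono hu.1).volume_lt hw hε hδ hu.2 hYu)
  · rw [Finset.mem_Icc] at hu
    exact (h.mono hu.1).four_mul_log_le hw hε hδ hu.2
  · rw [Finset.mem_Icc] at hu
    exact (hdev s (Finset.mem_Icc.2 ⟨hs, hst.trans htn⟩) u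
      (Finset.mem_Icc.2 ⟨hst.trans hu.1, hu.2⟩) j τ hτ).le

theorem abs_deg_sub_predictedDeg_le :
    |M.deg ξ s t - M.predictedDeg j n (M.deg ξ s n) t| ≤
      M.relError w * M.predictedDeg j n (M.deg ξ s n) t := by
  have hA₁ := M.A₁_pos
  have hA₂ := M.A₂_pos
  have hδ := M.unitBallVolume_mul_boundaryDist_pow_le_one hx
  have hmain := abs_deg_add_sub_div_growth_le hx hs hε hw hdev hst htn h
  have hθ := hw.ten_mul_inv_sqrt_lt_one
  have ht2 := h.two_le_time hw hε hδ
  have hαpos := M.exponent_nonneg j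
  have hαone := (M.exponent_lt_one j).le
  have hk : (0 : ℝ) ≤ M.deg ξ s n := Nat.cast_nonneg _
  have hupper := add_div_growth_le hαpos hαone htn (two_pos.trans_le ht2) hk (div_pos hA₂ hA₁).le
  have hlower := le_add_div_growth hαpos hαone htn ht2 hk (div_pos hA₂ hA₁).le
  have hB := h.le_div_mul_predictedDeg hw (div_pos hA₂ hA₁).le
  have htime : M.predictedDeg j n (M.deg ξ s n) t * (1 / t) ≤
      M.predictedDeg j n (M.deg ξ s n) t * (1 / (M.A₁ * w)) := by
    have := hw.pos
    have := h.predictedDeg_pos hw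
    gcongr
    exact h.mul_le_time hw hε hδ
  rw [← predictedDeg] at hupper hlower
  generalize M.predictedDeg j n (M.deg ξ s n) t = x at *
  have herr : M.relError w * x =
      10 * (√w)⁻¹ * x + 2 * (M.A₂ / M.A₁ / w * x) + x * (1 / (M.A₁ * w)) := by
    rw [relError, ← one_div_mul_one_div]
    ring
  have hD := mul_le_mul_of_nonneg_left hupper (show 0 ≤ 10 * (√w)⁻¹ by positivity)
  have hθB := mul_le_mul_of_nonneg_right hθ.le (div_pos hA₂ hA₁).le
  rw [abs_le] at hmain ⊢
  constructor <;> linarith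

omit hst htn in
theorem le_of_predictable (hsn : s ≤ n) : s ≤ t := by
  by_contra! hts
  have hself := abs_deg_sub_predictedDeg_le hx hs hε hw hdev le_rfl hsn (h.mono hts.le)
  have hpos := (h.mono hts.le).predictedDeg_pos hw
  rw [M.deg_eq_zero ξ le_rfl, Nat.cast_zero, zero_sub, abs_neg, abs_of_pos hpos] at hself
  exact hself.not_gt (mul_lt_of_lt_one_left hpos hw.relError_lt_one)

omit hx hs hst htn h in
theorem degreesPredicted_of_deviationsBounded (hlog : 1 ≤ Real.log n) :
    M.DegreesPredicted ξ n w ε (M.relError w) := by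
  rintro s hs hsn j hx _ rfl _ rfl hk hδ t ht htn
  have h : M.Predictable j ε w (M.boundaryDist j (pos ξ s)) n (M.deg ξ s n) t := by
    refine ⟨?_, hlog, hk, (le_max_left _ _).trans ht, (le_max_right _ _).trans ht⟩
    have hA₁ := M.A₁_pos
    have hA₂ := M.A₂_pos
    have hc := M.unitBallVolume_pos
    have hn : (0 : ℝ) < n := by exact_mod_cast hs.trans hsn
    refine lt_of_lt_of_le ?_ hδ
    unfold radius
    positivity
  have hst := le_of_predictable hx hs hε hw hdev h hsn
  exact abs_deg_sub_predictedDeg_le hx hs hε hw hdev hst htn h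

end SPAModel

end

theorem theorem1 {m : ℕ} (M : SPAModel m) (ω : ℕ → ℝ) (hω : Tendsto ω atTop atTop)
    (ε : ℝ) (hε : 0 < ε) :
    ∃ η : ℕ → ℝ, Tendsto η atTop (𝓝 0) ∧
      Tendsto (fun n : ℕ =>
          (n : ℝ) * M.prob.real {ξ | ¬ M.DegreesPredicted ξ n (ω n) ε (η n)})
        atTop (𝓝 0) := by
  refine ⟨fun n => M.relError (ω n), M.tendsto_relError.comp hω, ?_⟩
  refine squeeze_zero' (.of_forall fun n => by positivity) ?_
    (tendsto_const_div_atTop_nhds_zero_nat (2 * (Fintype.card (Fin m → Fin M.K) : ℝ)))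
  have hlog : ∀ᶠ n : ℕ in atTop, 1 ≤ Real.log n :=
    (Real.tendsto_log_atTop.comp tendsto_natCast_atTop_atTop).eventually_ge_atTop 1
  filter_upwards [hω.eventually (M.eventually_largeEnough hε), hlog, eventually_ge_atTop 1]
    with n hw hlog hn
  have hn' : (n : ℝ) ≠ 0 := by exact_mod_cast (Nat.one_le_iff_ne_zero.1 hn)
  have hsub : {ξ | ¬ M.DegreesPredicted ξ n (ω n) ε (M.relError (ω n))} ⊆
      {ξ | ¬ M.DeviationsBounded ξ n (√(ω n))⁻¹} := fun ξ hξ hdev =>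
    hξ (SPAModel.degreesPredicted_of_deviationsBounded hε hw hdev hlog)
  calc (n : ℝ) * M.prob.real {ξ | ¬ M.DegreesPredicted ξ n (ω n) ε (M.relError (ω n))}
      ≤ n * (2 * Fintype.card (Fin m → Fin M.K) * ((n : ℝ) ^ 2)⁻¹) := by
        gcongr
        exact (measureReal_mono hsub).trans
          (M.prob_not_deviationsBounded_le hn hw.abs_inv_sqrt_le_one)
    _ = _ := by field_simp
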